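/- Let $s\ge 2$ be an integer and let $\mathbb Z_s=\varprojlim \mathbb Z/s^n\mathbb Z$ be the compact ring of $s$-adic integers. Let $\mathcal V=\{(n,x): n\in\mathbb Z_{\ge 0},\ x\in\mathbb Z,\ 0\le x<s^n\}$ and let $H=\ell^2(\mathcal V)$ with canonical basis $\{E_{(n,x)}\}$. The Hensel shift is the isometry $V$ of $H$ with $VE_{(n,x)}=E_{(n+1,\,sx)}$, and for $f\in C(\mathbb Z_s)$ let $M_f$ be the bounded operator on $H$ with $M_fE_{(n,x)}=f(x)E_{(n,x)}$. The Hensel shift algebra is the C$^*$-algebra $A_V=C^*(V,M_f: f\in C(\mathbb Z_s))$ of operators on $H$. Let $X_V$ be the closed subspace $$X_V=\{(x,0):x\in\mathbb Z_s\}\cup\left\{\left(0,\tfrac1{n+1}\right):n\in\mathbb Z_{\ge 0}\right\}\subseteq \mathbb Z_s\times[0,1].$$ A function $F\in C(X_V)$ is identified with the pair $(f,(x_n)_{n\ge 0})$, where $f(x)=F(x,0)$ belongs to $C(\mathbb Z_s)$ and $x_n=F(0,\tfrac1{n+1})$ satisfies $\lim_{n\to\infty} x_n=f(0)$. Let $\tilde\alpha_V$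 be the endomorphism of $C(X_V)$ given by $$\tilde\alpha_V(f,(x_n)_{n\ge 0})=(\mathfrak a_Vf,(x_{n-1})_{n\ge 0}),\qquad x_{-1}=0,$$ where $\mathfrak a_Vf(x)=f(x/s)$ if $s\mid x$ and $\mathfrak a_Vf(x)=0$ otherwise. For an endomorphism $\alpha$ of a unital C$^*$-algebra $A$ (not necessarily preserving the unit), $A\rtimes_\alpha\mathbb N$ denotes the universal unital C$^*$-algebra generated by the elements of $A$ (with the same unit) and an isometry $J$, subject to the relations $\alpha(a)=JaJ^*$ for all $a\in A$. **Theorem.** There is an isomorphism of C$^*$-algebras $$A_V\cong C(X_V)\rtimes_{\tilde\alpha_V}\mathbb N.$$ -/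

import Mathlib

open Filter Topology

universe u v

/-! ### The crossed product of a unital C*-algebra by an endomorphism -/

/-- A covariant pair for `(A, α)` in a unital C*-algebra `B`: a unital `*`-homomorphism `π : A → B`
and an isometry `J` of `B` such that `π (α a) = J π(a) J*` for all `a`. -/
structure CovariantPair {A : Type u} [CStarAlgebra A] (α : A →⋆ₙₐ[ℂ] A)
    (B : Type v) [CStarAlgebra B] where
  π : A →⋆ₐ[ℂ] B
  J : B
  isometry : star J * J = 1
  covariant : ∀ a, π (α a) = J * π a * star J

/-- Formal generators: the elements of `A`, a letter `iso`, and a letter `isoStar` for its adjoint. -/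
inductive CrossedGen (A : Type u) : Type u
  | coeff (a : A)
  | iso
  | isoStar

/-- The adjoint of a formal generator. -/
def CrossedGen.adj {A : Type u} [Star A] : CrossedGen A → CrossedGen A
  | .coeff a => .coeff (star a)
  | .iso => .isoStar
  | .isoStar => .iso

/-- The free complex `*`-algebra on the formal generators (noncommutative polynomials in the
generators). It carries the endomorphism `α` as a parameter because its seminorm depends on `α`. -/
def CrossedPoly {A : Type u} [CStarAlgebra A] (_α : A →⋆ₙₐ[ℂ] A) : Type u :=
  FreeAlgebra ℂ (CrossedGen A)

noncomputable section CrossedProduct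

namespace CrossedPoly

variable {A : Type u} [CStarAlgebra A] (α : A →⋆ₙₐ[ℂ] A)

instance : Ring (CrossedPoly α) := inferInstanceAs (Ring (FreeAlgebra ℂ (CrossedGen A)))
instance : Algebra ℂ (CrossedPoly α) :=
  inferInstanceAs (Algebra ℂ (FreeAlgebra ℂ (CrossedGen A)))

/-- A generator as a polynomial. -/
def gen (g : CrossedGen A) : CrossedPoly α := FreeAlgebra.ι ℂ g

variable {α}

theorem induction {motive : CrossedPoly α → Prop}
    (scalar : ∀ r : ℂ, motive (algebraMap ℂ _ r)) (gen : ∀ g, motive (gen α g))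
    (mul : ∀ x y, motive x → motive y → motive (x * y))
    (add : ∀ x y, motive x → motive y → motive (x + y)) (x : CrossedPoly α) : motive x :=
  FreeAlgebra.induction ℂ (CrossedGen A) (motive := motive) scalar gen mul add x

variable (α) in
/-- The opposite ring of the polynomials, as a `ℂ`-algebra with conjugated scalars. -/
abbrev conjOpAlgebra : Algebra ℂ (CrossedPoly α)ᵐᵒᵖ :=
  RingHom.toAlgebra' ((algebraMap ℂ (CrossedPoly α)ᵐᵒᵖ).comp (starRingEnd ℂ))
    (fun c x => Algebra.commutes (starRingEnd ℂ c) x)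

variable (α) in
/-- The involution: antimultiplicative, conjugate linear, sending each generator to its adjoint. -/
def starAux : CrossedPoly α →+* (CrossedPoly α)ᵐᵒᵖ :=
  letI := conjOpAlgebra α
  (FreeAlgebra.lift ℂ (fun g : CrossedGen A => MulOpposite.op (gen α g.adj))).toRingHom

theorem starAux_algebraMap (r : ℂ) :
    starAux α (algebraMap ℂ _ r) = MulOpposite.op (algebraMap ℂ _ (starRingEnd ℂ r)) := by
  let _ := conjOpAlgebra α
  exact (FreeAlgebra.lift ℂ (fun g : CrossedGen A => MulOpposite.op (gen α g.adj))).commutes r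

theorem starAux_gen (g : CrossedGen A) :
    starAux α (gen α g) = MulOpposite.op (gen α g.adj) := by
  let _ := conjOpAlgebra α
  exact FreeAlgebra.lift_ι_apply (fun g : CrossedGen A => MulOpposite.op (gen α g.adj)) g

instance : StarRing (CrossedPoly α) where
  star x := (starAux α x).unop
  star_involutive x := by
    induction x using CrossedPoly.induction with
    | scalar r => simp [starAux_algebraMap]
    | gen g => cases g <;> simp [starAux_gen, CrossedGen.adj]
    | mul x y hx hy => simp only [map_mul, MulOpposite.unop_mul, hx, hy]
    | add x y hx hy => simp only [map_add, MulOpposite.unop_add, hx, hy]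
  star_mul x y := by simp only [map_mul, MulOpposite.unop_mul]
  star_add x y := by simp only [map_add, MulOpposite.unop_add]

theorem star_algebraMap (r : ℂ) :
    star (algebraMap ℂ (CrossedPoly α) r) = algebraMap ℂ _ (starRingEnd ℂ r) :=
  congrArg MulOpposite.unop (starAux_algebraMap r)

theorem star_gen (g : CrossedGen A) : star (gen α g) = gen α g.adj :=
  congrArg MulOpposite.unop (starAux_gen g)

end CrossedPoly

namespace CovariantPair

variable {A : Type u} [CStarAlgebra A] {α : A →⋆ₙₐ[ℂ] A}
  {B : Type v} [CStarAlgebra B] (c : CovariantPair α B)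

/-- Evaluation of polynomials at a covariant pair. -/
def eval : CrossedPoly α →ₐ[ℂ] B :=
  FreeAlgebra.lift ℂ fun g : CrossedGen A =>
    match g with
    | .coeff a => c.π a
    | .iso => c.J
    | .isoStar => star c.J

theorem eval_coeff (a : A) : c.eval (CrossedPoly.gen α (.coeff a)) = c.π a :=
  FreeAlgebra.lift_ι_apply _ _

theorem eval_iso : c.eval (CrossedPoly.gen α .iso) = c.J :=
  FreeAlgebra.lift_ι_apply _ _

theorem eval_isoStar : c.eval (CrossedPoly.gen α .isoStar) = star c.J :=
  FreeAlgebra.lift_ι_apply _ _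

theorem eval_star (x : CrossedPoly α) : c.eval (star x) = star (c.eval x) := by
  induction x using CrossedPoly.induction with
  | scalar r =>
    rw [CrossedPoly.star_algebraMap, AlgHom.commutes, AlgHom.commutes]
    exact algebraMap_star_comm r
  | gen g =>
    rw [CrossedPoly.star_gen]
    cases g <;>
      simp [CrossedGen.adj, eval_coeff, eval_iso, eval_isoStar, map_star]
  | mul x y hx hy => simp [hx, hy]
  | add x y hx hy => simp [hx, hy]

end CovariantPair

namespace CrossedPoly

variable {A : Type u} [CStarAlgebra A] {α : A →⋆ₙₐ[ℂ] A}

/-- The values `‖x(π, J)‖` taken by a polynomial over all covariant pairs. -/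
def normSet (x : CrossedPoly α) : Set ℝ :=
  {r | ∃ (B : Type u) (_ : CStarAlgebra B) (c : CovariantPair α B), r = ‖c.eval x‖}

theorem norm_one_le (B : Type u) [CStarAlgebra B] : ‖(1 : B)‖ ≤ 1 := by
  rcases subsingleton_or_nontrivial B with h | h
  · rw [Subsingleton.elim (1 : B) 0, norm_zero]; exact zero_le_one
  · exact (CStarRing.norm_one (E := B)).le

theorem exists_bound (x : CrossedPoly α) : ∃ C : ℝ, 0 ≤ C ∧
    ∀ (B : Type u) [CStarAlgebra B] (c : CovariantPair α B), ‖c.eval x‖ ≤ C := by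
  have hJ : ∀ (B : Type u) [CStarAlgebra B] (c : CovariantPair α B), ‖c.J‖ ≤ 1 := by
    intro B _ c
    have h := CStarRing.norm_star_mul_self (x := c.J)
    rw [c.isometry] at h
    have := norm_one_le B
    nlinarith [norm_nonneg c.J]
  induction x using CrossedPoly.induction with
  | scalar r =>
    refine ⟨‖r‖, norm_nonneg r, fun B _ c => ?_⟩
    rw [AlgHom.commutes, Algebra.algebraMap_eq_smul_one]
    refine (norm_smul_le _ _).trans ?_
    exact mul_le_of_le_one_right (norm_nonneg r) (norm_one_le B)
  | gen g =>
    cases g with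
    | coeff a =>
      refine ⟨‖a‖, norm_nonneg a, fun B _ c => ?_⟩
      rw [c.eval_coeff]
      exact NonUnitalStarAlgHom.norm_apply_le c.π a
    | iso =>
      refine ⟨1, zero_le_one, fun B _ c => ?_⟩
      rw [c.eval_iso]
      exact hJ B c
    | isoStar =>
      refine ⟨1, zero_le_one, fun B _ c => ?_⟩
      rw [c.eval_isoStar, norm_star]
      exact hJ B c
  | mul x y hx hy =>
    obtain ⟨C, hC, hx⟩ := hx
    obtain ⟨D, hD, hy⟩ := hy
    refine ⟨C * D, mul_nonneg hC hD, fun B _ c => ?_⟩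
    rw [map_mul]
    exact (norm_mul_le _ _).trans (mul_le_mul (hx B c) (hy B c) (norm_nonneg _) hC)
  | add x y hx hy =>
    obtain ⟨C, hC, hx⟩ := hx
    obtain ⟨D, hD, hy⟩ := hy
    refine ⟨C + D, add_nonneg hC hD, fun B _ c => ?_⟩
    rw [map_add]
    exact (norm_add_le _ _).trans (add_le_add (hx B c) (hy B c))

theorem bddAbove_normSet (x : CrossedPoly α) : BddAbove (normSet x) := by
  obtain ⟨C, -, h⟩ := exists_bound x
  refine ⟨C, ?_⟩
  rintro r ⟨B, _, c, rfl⟩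
  exact h B c

/-- The universal C*-seminorm: the supremum of `‖x(π, J)‖` over all covariant pairs `(π, J)`. -/
def univNorm (x : CrossedPoly α) : ℝ := sSup (normSet x)

theorem norm_eval_le {B : Type u} [CStarAlgebra B] (c : CovariantPair α B) (x : CrossedPoly α) :
    ‖c.eval x‖ ≤ univNorm x :=
  le_csSup (bddAbove_normSet x) ⟨B, _, c, rfl⟩

theorem univNorm_nonneg (x : CrossedPoly α) : 0 ≤ univNorm x := by
  refine Real.sSup_nonneg ?_
  rintro r ⟨B, _, c, rfl⟩
  exact norm_nonneg _

theorem univNorm_le {x : CrossedPoly α} {C : ℝ} (hC : 0 ≤ C)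
    (h : ∀ (B : Type u) [CStarAlgebra B] (c : CovariantPair α B), ‖c.eval x‖ ≤ C) :
    univNorm x ≤ C := by
  refine Real.sSup_le ?_ hC
  rintro r ⟨B, _, c, rfl⟩
  exact h B c

theorem univNorm_star (x : CrossedPoly α) : univNorm (star x) = univNorm x := by
  unfold univNorm normSet
  simp only [CovariantPair.eval_star, norm_star]

instance : SeminormedRing (CrossedPoly α) where
  __ := (inferInstance : Ring (CrossedPoly α))
  __ := AddGroupSeminorm.toSeminormedAddCommGroup (E := CrossedPoly α)
    { toFun := univNorm
      map_zero' := le_antisymm (univNorm_le le_rfl fun B _ c => by simp) (univNorm_nonneg 0)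
      add_le' := fun x y => univNorm_le (add_nonneg (univNorm_nonneg x) (univNorm_nonneg y))
        fun B _ c => by
          rw [map_add]
          exact (norm_add_le _ _).trans (add_le_add (norm_eval_le c x) (norm_eval_le c y))
      neg' := fun x => by
        unfold univNorm normSet
        simp only [map_neg, norm_neg] }
  norm_mul_le x y := univNorm_le (mul_nonneg (univNorm_nonneg x) (univNorm_nonneg y))
    fun B _ c => by
      rw [map_mul]
      exact (norm_mul_le _ _).trans
        (mul_le_mul (norm_eval_le c x) (norm_eval_le c y) (norm_nonneg _) (univNorm_nonneg x))

theorem norm_def (x : CrossedPoly α) : ‖x‖ = univNorm x := rfl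

instance : NormedAlgebra ℂ (CrossedPoly α) where
  norm_smul_le r x := univNorm_le (mul_nonneg (norm_nonneg r) (univNorm_nonneg x))
    fun B _ c => by
      rw [map_smul]
      exact (norm_smul_le _ _).trans
        (mul_le_mul_of_nonneg_left (norm_eval_le c x) (norm_nonneg r))

theorem norm_mul_self_le (x : CrossedPoly α) : ‖x‖ * ‖x‖ ≤ ‖star x * x‖ := by
  have h : ‖x‖ ≤ √‖star x * x‖ := univNorm_le (Real.sqrt_nonneg _) fun B _ c => by
    refine Real.le_sqrt_of_sq_le ?_
    rw [sq, ← CStarRing.norm_star_mul_self, ← c.eval_star, ← map_mul]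
    exact norm_eval_le c _
  calc ‖x‖ * ‖x‖ ≤ √‖star x * x‖ * √‖star x * x‖ :=
        mul_le_mul h h (norm_nonneg _) (Real.sqrt_nonneg _)
    _ = ‖star x * x‖ := Real.mul_self_sqrt (norm_nonneg _)

instance : NormedStarGroup (CrossedPoly α) where
  norm_star_le x := (univNorm_star x).le

instance : StarModule ℂ (CrossedPoly α) where
  star_smul r x := by
    rw [Algebra.smul_def, star_mul, star_algebraMap, Algebra.smul_def, ← Algebra.commutes]
    rfl

end CrossedPoly

/-- The crossed product `A ⋊_α ℕ`: the universal unital C*-algebra generated by the elements of `A`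
and an isometry `J` subject to `α(a) = J a J*`, i.e. the (Hausdorff) completion of the free
`*`-algebra on the generators in the universal C*-seminorm. -/
def CrossedProduct {A : Type u} [CStarAlgebra A] (α : A →⋆ₙₐ[ℂ] A) : Type u :=
  UniformSpace.Completion (CrossedPoly α)

namespace CrossedProduct

open UniformSpace UniformSpace.Completion

variable {A : Type u} [CStarAlgebra A] {α : A →⋆ₙₐ[ℂ] A}

instance : NormedRing (CrossedProduct α) :=
  inferInstanceAs (NormedRing (Completion (CrossedPoly α)))

instance : CompleteSpace (CrossedProduct α) :=
  inferInstanceAs (CompleteSpace (Completion (CrossedPoly α)))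

instance : Algebra ℂ (CrossedProduct α) :=
  inferInstanceAs (Algebra ℂ (Completion (CrossedPoly α)))

instance : NormedAlgebra ℂ (CrossedProduct α) where
  norm_smul_le r x := norm_smul_le (β := Completion (CrossedPoly α)) r x

variable (α) in
/-- The class of a polynomial in the crossed product. -/
def mk : CrossedPoly α →ₐ[ℂ] CrossedProduct α where
  toFun x := (x : Completion (CrossedPoly α))
  map_one' := rfl
  map_mul' x y := Completion.coe_mul x y
  map_zero' := rfl
  map_add' x y := Completion.coe_add x y
  commutes' _ := rfl

theorem norm_mk (x : CrossedPoly α) : ‖mk α x‖ = ‖x‖ := Completion.norm_coe x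

theorem isometry_mk : Isometry (mk α) := Completion.coe_isometry

theorem denseRange_mk : DenseRange (mk α) := Completion.denseRange_coe

/-- The involution, extended from polynomials by continuity. -/
instance : Star (CrossedProduct α) where
  star := Completion.map (star : CrossedPoly α → CrossedPoly α)

theorem star_mk (x : CrossedPoly α) : star (mk α x) = mk α (star x) :=
  Completion.map_coe (star_isometry (E := CrossedPoly α)).uniformContinuous x

theorem continuous_star' : Continuous (star : CrossedProduct α → CrossedProduct α) :=
  Completion.continuous_map

theorem induction₁ {p : CrossedProduct α → Prop} (hp : IsClosed {x | p x})
    (h : ∀ x, p (mk α x)) (x : CrossedProduct α) : p x :=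
  Completion.induction_on x hp h

instance : StarRing (CrossedProduct α) where
  star_involutive x := by
    refine induction₁ (p := fun x => star (star x) = x) ?_ ?_ x
    · exact isClosed_eq (continuous_star'.comp continuous_star') continuous_id
    · intro x; rw [star_mk, star_mk, star_star]
  star_mul x y := by
    refine induction₁ (p := fun x => star (x * y) = star y * star x) ?_ (fun x => ?_) x
    · exact isClosed_eq (continuous_star'.comp (continuous_mul_const y))
        (continuous_const.mul continuous_star')
    refine induction₁ (p := fun y => star (mk α x * y) = star y * star (mk α x)) ?_ ?_ y
    · exact isClosed_eq (continuous_star'.comp (continuous_const_mul _))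
        (continuous_star'.mul continuous_const)
    · intro y; rw [← map_mul, star_mk, star_mk, star_mk, star_mul, map_mul]
  star_add x y := by
    refine induction₁ (p := fun x => star (x + y) = star x + star y) ?_ (fun x => ?_) x
    · exact isClosed_eq (continuous_star'.comp (continuous_add_const y))
        (continuous_star'.add continuous_const)
    refine induction₁ (p := fun y => star (mk α x + y) = star (mk α x) + star y) ?_ ?_ y
    · exact isClosed_eq (continuous_star'.comp (continuous_const_add _))
        (continuous_const.add continuous_star')
    · intro y; rw [← map_add, star_mk, star_mk, star_mk, star_add, map_add]

instance : CStarRing (CrossedProduct α) where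
  norm_mul_self_le x := by
    refine induction₁ (p := fun x => ‖x‖ * ‖x‖ ≤ ‖star x * x‖) ?_ ?_ x
    · exact isClosed_le (continuous_norm.mul continuous_norm)
        (continuous_star'.mul continuous_id).norm
    · intro x
      rw [star_mk, ← map_mul, norm_mk, norm_mk]
      exact CrossedPoly.norm_mul_self_le x

instance : StarModule ℂ (CrossedProduct α) where
  star_smul r x := by
    refine induction₁ (p := fun x => star (r • x) = star r • star x) ?_ ?_ x
    · exact isClosed_eq (continuous_star'.comp (continuous_const_smul r))
        (continuous_star'.const_smul (star r))
    · intro x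
      rw [← map_smul, star_mk, star_mk, star_smul, map_smul]

instance : CStarAlgebra (CrossedProduct α) where

theorem mk_eq_of_eval_eq {x y : CrossedPoly α}
    (h : ∀ (B : Type u) [CStarAlgebra B] (c : CovariantPair α B), c.eval x = c.eval y) :
    mk α x = mk α y := by
  rw [← sub_eq_zero, ← norm_eq_zero, ← map_sub, norm_mk]
  refine le_antisymm (CrossedPoly.univNorm_le le_rfl fun B _ c => ?_) (norm_nonneg _)
  rw [map_sub, h, sub_self, norm_zero]

variable (α) in
/-- The universal covariant pair, in the crossed product itself. -/
def univPair : CovariantPair α (CrossedProduct α) where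
  π :=
    { toFun := fun a => mk α (CrossedPoly.gen α (.coeff a))
      map_one' := by
        rw [← map_one (mk α)]
        exact mk_eq_of_eval_eq fun B _ c => by simp [c.eval_coeff]
      map_mul' := fun a b => by
        rw [← map_mul (mk α)]
        exact mk_eq_of_eval_eq fun B _ c => by simp [c.eval_coeff]
      map_zero' := by
        rw [← map_zero (mk α)]
        exact mk_eq_of_eval_eq fun B _ c => by simp [c.eval_coeff]
      map_add' := fun a b => by
        rw [← map_add (mk α)]
        exact mk_eq_of_eval_eq fun B _ c => by simp [c.eval_coeff]
      commutes' := fun r => by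
        rw [← (mk α).commutes]
        exact mk_eq_of_eval_eq fun B _ c => by
          rw [c.eval_coeff, AlgHom.commutes]
          exact AlgHomClass.commutes c.π r
      map_star' := fun a => by
        rw [star_mk, CrossedPoly.star_gen]
        rfl }
  J := mk α (CrossedPoly.gen α .iso)
  isometry := by
    rw [star_mk, ← map_mul, ← map_one (mk α)]
    exact mk_eq_of_eval_eq fun B _ c => by
      rw [map_mul, c.eval_star, c.eval_iso, c.isometry, map_one]
  covariant := fun a => by
    change mk α _ = _ * mk α _ * _
    rw [star_mk, ← map_mul, ← map_mul]
    exact mk_eq_of_eval_eq fun B _ c => by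
      rw [map_mul, map_mul, c.eval_star, c.eval_iso, c.eval_coeff, c.eval_coeff, c.covariant]

theorem univPair_eval (x : CrossedPoly α) : (univPair α).eval x = mk α x := by
  induction x using CrossedPoly.induction with
  | scalar r => rw [AlgHom.commutes, AlgHom.commutes]
  | gen g =>
    cases g with
    | coeff a => rw [CovariantPair.eval_coeff]; rfl
    | iso => rw [CovariantPair.eval_iso]; rfl
    | isoStar =>
      rw [CovariantPair.eval_isoStar]
      exact (star_mk _).trans (by rw [CrossedPoly.star_gen]; rfl)
  | mul x y hx hy => rw [map_mul, map_mul, hx, hy]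
  | add x y hx hy => rw [map_add, map_add, hx, hy]

/-- The universal property, existence: every covariant pair factors through the crossed product. -/
theorem exists_lift {B : Type u} [CStarAlgebra B] (c : CovariantPair α B) :
    ∃ φ : CrossedProduct α →⋆ₐ[ℂ] B,
      (∀ a, φ ((univPair α).π a) = c.π a) ∧ φ (univPair α).J = c.J := by
  have hlip : LipschitzWith 1 c.eval := AddMonoidHomClass.lipschitz_of_bound_nnnorm c.eval 1
    fun x => by
      rw [one_mul]
      exact CrossedPoly.norm_eval_le c x
  have hu : UniformContinuous c.eval := hlip.uniformContinuous
  have hc : Continuous (Completion.extension c.eval) := Completion.continuous_extension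
  have hmk : ∀ x : CrossedPoly α,
      (Completion.extension c.eval : CrossedProduct α → B) (mk α x) = c.eval x :=
    fun x => Completion.extension_coe hu x
  let φ₀ : CrossedProduct α → B := Completion.extension c.eval
  have hc₀ : Continuous φ₀ := hc
  have hmk₀ : ∀ x, φ₀ (mk α x) = c.eval x := hmk
  have hmul : ∀ x y, φ₀ (x * y) = φ₀ x * φ₀ y := fun x y => by
    refine induction₁ (p := fun x => φ₀ (x * y) = φ₀ x * φ₀ y) ?_ (fun x => ?_) x
    · exact isClosed_eq (hc₀.comp (continuous_mul_const y)) (hc₀.mul continuous_const)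
    refine induction₁ (p := fun y => φ₀ (mk α x * y) = φ₀ (mk α x) * φ₀ y) ?_ ?_ y
    · exact isClosed_eq (hc₀.comp (continuous_const_mul _)) (continuous_const.mul hc₀)
    · intro y; rw [← map_mul, hmk₀, hmk₀, hmk₀, map_mul]
  have hadd : ∀ x y, φ₀ (x + y) = φ₀ x + φ₀ y := fun x y => by
    refine induction₁ (p := fun x => φ₀ (x + y) = φ₀ x + φ₀ y) ?_ (fun x => ?_) x
    · exact isClosed_eq (hc₀.comp (continuous_add_const y)) (hc₀.add continuous_const)
    refine induction₁ (p := fun y => φ₀ (mk α x + y) = φ₀ (mk α x) + φ₀ y) ?_ ?_ y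
    · exact isClosed_eq (hc₀.comp (continuous_const_add _)) (continuous_const.add hc₀)
    · intro y; rw [← map_add, hmk₀, hmk₀, hmk₀, map_add]
  have hstar : ∀ x, φ₀ (star x) = star (φ₀ x) := fun x => by
    refine induction₁ (p := fun x => φ₀ (star x) = star (φ₀ x)) ?_ (fun x => ?_) x
    · exact isClosed_eq (hc₀.comp continuous_star') hc₀.star
    · rw [star_mk, hmk₀, hmk₀, c.eval_star]
  have halg : ∀ r : ℂ, φ₀ (algebraMap ℂ _ r) = algebraMap ℂ _ r := fun r => by
    rw [← (mk α).commutes, hmk₀, AlgHom.commutes]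
  refine ⟨{ toFun := φ₀
            map_one' := by simpa using halg 1
            map_mul' := hmul
            map_zero' := by simpa using halg 0
            map_add' := hadd
            commutes' := halg
            map_star' := hstar }, fun a => ?_, ?_⟩
  · exact (hmk₀ _).trans (c.eval_coeff a)
  · exact (hmk₀ _).trans c.eval_iso

/-- The universal property, uniqueness: a `*`-homomorphism on the crossed product is determined by
its values on the generators. -/
theorem hom_ext {B : Type v} [CStarAlgebra B] {φ ψ : CrossedProduct α →⋆ₐ[ℂ] B}
    (hπ : ∀ a, φ ((univPair α).π a) = ψ ((univPair α).π a))
    (hJ : φ (univPair α).J = ψ (univPair α).J) : φ = ψ := by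
  ext x
  refine induction₁ (p := fun x => φ x = ψ x) ?_ (fun x => ?_) x
  · have hcont : ∀ f : CrossedProduct α →⋆ₐ[ℂ] B, Continuous f := fun f =>
      AddMonoidHomClass.continuous_of_bound f 1 fun x => by
        rw [one_mul]
        exact NonUnitalStarAlgHom.norm_apply_le f x
    exact isClosed_eq (hcont φ) (hcont ψ)
  rw [← univPair_eval]
  induction x using CrossedPoly.induction with
  | scalar r => simp only [AlgHomClass.commutes]
  | gen g =>
    cases g with
    | coeff a => rw [CovariantPair.eval_coeff, hπ]
    | iso => rw [CovariantPair.eval_iso, hJ]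
    | isoStar => rw [CovariantPair.eval_isoStar, map_star, map_star, hJ]
  | mul x y hx hy => rw [map_mul, map_mul, map_mul, hx, hy]
  | add x y hx hy => rw [map_add, map_add, map_add, hx, hy]

end CrossedProduct

end CrossedProduct

/-! ### The `s`-adic integers -/

noncomputable section SAdic

/-- The ring of `s`-adic integers, as the projective limit of the rings `ℤ / s ^ n ℤ`. Its topology
is the one induced by the product of the discrete topologies. -/
def SAdicInt (s : ℕ) : Subring (∀ n : ℕ, ZMod (s ^ n)) where
  carrier := {x | ∀ n, ZMod.castHom (pow_dvd_pow s n.le_succ) (ZMod (s ^ n)) (x (n + 1)) = x n}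
  mul_mem' hx hy n := by
    rw [Pi.mul_apply, map_mul, hx n, hy n, Pi.mul_apply]
  one_mem' n := by rw [Pi.one_apply, map_one, Pi.one_apply]
  add_mem' hx hy n := by
    rw [Pi.add_apply, map_add, hx n, hy n, Pi.add_apply]
  zero_mem' n := by rw [Pi.zero_apply, map_zero, Pi.zero_apply]
  neg_mem' hx n := by
    rw [Pi.neg_apply, map_neg, hx n, Pi.neg_apply]

namespace SAdicInt

variable {s : ℕ}

theorem isClosed_coe (s : ℕ) : IsClosed (SAdicInt s : Set (∀ n : ℕ, ZMod (s ^ n))) := by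
  have h : (SAdicInt s : Set (∀ n : ℕ, ZMod (s ^ n))) =
      ⋂ n, {x | ZMod.castHom (pow_dvd_pow s n.le_succ) (ZMod (s ^ n)) (x (n + 1)) = x n} := by
    ext x; simp [SAdicInt]
  rw [h]
  refine isClosed_iInter fun n => isClosed_eq ?_ (continuous_apply n)
  exact continuous_of_discreteTopology.comp (continuous_apply (n + 1))

instance [s.AtLeastTwo] : CompactSpace (SAdicInt s) := by
  have : ∀ n : ℕ, NeZero (s ^ n) := fun n => inferInstance
  exact isCompact_iff_compactSpace.mp (isClosed_coe s).isCompact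

theorem ext' {x y : SAdicInt s} (h : ∀ n, x.1 n = y.1 n) : x = y := Subtype.ext (funext h)

theorem val_succ_mod [s.AtLeastTwo] (x : SAdicInt s) (n : ℕ) : (x.1 (n + 1)).val % s ^ n = (x.1 n).val := by
  have h := congrArg ZMod.val (x.2 n)
  rw [← ZMod.natCast_zmod_val (x.1 (n + 1)), map_natCast, ZMod.val_natCast] at h
  exact h

theorem mul_left_injective (s : ℕ) [s.AtLeastTwo] :
    Function.Injective (fun y : SAdicInt s => (s : SAdicInt s) * y) := by
  intro x y hxy
  have key : ∀ z : SAdicInt s, (s : SAdicInt s) * z = 0 → z = 0 := by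
    intro z hz
    refine ext' fun n => ?_
    have hspos : 0 < s := (NeZero.pos s)
    have h : ((s * (z.1 (n + 1)).val : ℕ) : ZMod (s ^ (n + 1))) = 0 := by
      have := congrFun (congrArg Subtype.val hz) (n + 1)
      push_cast
      rw [ZMod.natCast_zmod_val]
      simpa using this
    rw [ZMod.natCast_eq_zero_iff] at h
    have h' : s ^ n ∣ (z.1 (n + 1)).val :=
      Nat.dvd_of_mul_dvd_mul_left hspos ((dvd_of_eq (pow_succ' s n).symm).trans h)
    have h2 := val_succ_mod z n
    rw [Nat.mod_eq_zero_of_dvd h'] at h2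
    exact (ZMod.val_eq_zero _).mp h2.symm
  have := key (x - y) (by rw [mul_sub, sub_eq_zero]; exact hxy)
  exact sub_eq_zero.mp this

theorem dvd_iff [s.AtLeastTwo] (x : SAdicInt s) : (s : SAdicInt s) ∣ x ↔ x.1 1 = 0 := by
  have hspos : 0 < s := NeZero.pos s
  constructor
  · rintro ⟨y, rfl⟩
    have h : ((s : ℕ) : ZMod (s ^ 1)) = 0 := by rw [ZMod.natCast_eq_zero_iff, pow_one]
    have h2 : ((s : SAdicInt s) * y).1 1 = ((s : ℕ) : ZMod (s ^ 1)) * y.1 1 := by simp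
    rw [h2, h, zero_mul]
  · intro hx
    have hmod : ∀ n m, n ≤ m → (x.1 m).val % s ^ n = (x.1 n).val := by
      intro n m hnm
      induction m, hnm using Nat.le_induction with
      | base => exact Nat.mod_eq_of_lt (ZMod.val_lt _)
      | succ m hm ih =>
        rw [← ih, ← val_succ_mod x m, Nat.mod_mod_of_dvd _ (pow_dvd_pow s hm)]
    have hdvd : ∀ n, s ∣ (x.1 (n + 1)).val := by
      intro n
      have h := hmod 1 (n + 1) (by omega)
      rw [hx, ZMod.val_zero, pow_one] at h
      exact Nat.dvd_of_mod_eq_zero h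
    refine ⟨⟨fun n => (((x.1 (n + 1)).val / s : ℕ) : ZMod (s ^ n)), fun n => ?_⟩, ?_⟩
    · rw [map_natCast, ZMod.natCast_eq_natCast_iff]
      have h := val_succ_mod x (n + 1)
      obtain ⟨a, ha⟩ := hdvd (n + 1)
      obtain ⟨b, hb⟩ := hdvd n
      rw [ha, hb, pow_succ', Nat.mul_mod_mul_left] at h
      have h' := Nat.eq_of_mul_eq_mul_left hspos h
      rw [ha, hb, Nat.mul_div_cancel_left _ hspos, Nat.mul_div_cancel_left _ hspos, ← h']
      exact (Nat.mod_modEq _ _).symm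
    · refine ext' fun n => ?_
      have h2 : ∀ y : SAdicInt s, ((s : SAdicInt s) * y).1 n = ((s : ℕ) : ZMod (s ^ n)) * y.1 n :=
        fun y => by simp
      rw [h2]
      dsimp only
      rw [← Nat.cast_mul, Nat.mul_div_cancel' (hdvd n), ← ZMod.natCast_zmod_val (x.1 n),
        ← val_succ_mod x n, ZMod.natCast_mod]

theorem isOpenEmbedding_mul (s : ℕ) [s.AtLeastTwo] :
    IsOpenEmbedding (fun y : SAdicInt s => (s : SAdicInt s) * y) := by
  have hc : Continuous (fun y : SAdicInt s => (s : SAdicInt s) * y) := by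
    refine Continuous.subtype_mk ?_ _
    refine continuous_pi fun n => ?_
    exact (continuous_of_discreteTopology (f := fun a : ZMod (s ^ n) => _ * a)).comp
      ((continuous_apply n).comp continuous_subtype_val)
  refine ⟨(hc.isClosedEmbedding (mul_left_injective s)).isEmbedding, ?_⟩
  have hr : Set.range (fun y : SAdicInt s => (s : SAdicInt s) * y) =
      (fun x : SAdicInt s => x.1 1) ⁻¹' {0} := by
    ext x
    rw [Set.mem_preimage, Set.mem_singleton_iff, ← dvd_iff]
    exact ⟨fun ⟨y, hy⟩ => ⟨y, hy.symm⟩, fun ⟨y, hy⟩ => ⟨y, hy.symm⟩⟩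
  rw [hr]
  exact (isOpen_discrete _).preimage ((continuous_apply 1).comp continuous_subtype_val)

open Classical in
/-- The function `𝔞_V f`, equal to `f (x / s)` if `s ∣ x` and to `0` otherwise. -/
def aFun (f : SAdicInt s → ℂ) (x : SAdicInt s) : ℂ :=
  if h : ∃ y : SAdicInt s, x = s * y then f h.choose else 0

theorem aFun_mul [s.AtLeastTwo] (f : SAdicInt s → ℂ) (y : SAdicInt s) : aFun f (s * y) = f y := by
  have h : ∃ z : SAdicInt s, s * y = s * z := ⟨y, rfl⟩
  rw [aFun, dif_pos h]
  exact congrArg f (mul_left_injective s h.choose_spec.symm)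

theorem aFun_of_not_dvd (f : SAdicInt s → ℂ) {x : SAdicInt s} (hx : ¬ (s : SAdicInt s) ∣ x) :
    aFun f x = 0 := dif_neg hx

theorem continuous_aFun [s.AtLeastTwo] {f : SAdicInt s → ℂ} (hf : Continuous f) : Continuous (aFun f) := by
  have ho := isOpenEmbedding_mul s
  have hcl := ho.isEmbedding.continuous.isClosedEmbedding (mul_left_injective s)
  refine continuous_iff_continuousAt.mpr fun x => ?_
  by_cases hx : (s : SAdicInt s) ∣ x
  · obtain ⟨y, rfl⟩ := hx
    rw [← ho.continuousAt_iff (x := y)]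
    have : aFun f ∘ (fun y : SAdicInt s => (s : SAdicInt s) * y) = f :=
      funext fun y => aFun_mul f y
    rw [this]
    exact hf.continuousAt
  · have hmem : (Set.range (fun y : SAdicInt s => (s : SAdicInt s) * y))ᶜ ∈ 𝓝 x := by
      refine hcl.isClosed_range.isOpen_compl.mem_nhds ?_
      rintro ⟨y, rfl⟩
      exact hx ⟨y, rfl⟩
    refine (continuousAt_const (y := (0 : ℂ))).congr ?_
    filter_upwards [hmem] with z hz
    refine (aFun_of_not_dvd f ?_).symm
    rintro ⟨y, rfl⟩
    exact hz ⟨y, rfl⟩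

theorem aFun_cases {p : SAdicInt s → Prop} (h1 : ∀ y, p (s * y))
    (h2 : ∀ x, ¬ (s : SAdicInt s) ∣ x → p x) (x : SAdicInt s) : p x := by
  by_cases hx : (s : SAdicInt s) ∣ x
  · obtain ⟨y, rfl⟩ := hx
    exact h1 y
  · exact h2 x hx

/-- The endomorphism `𝔞_V` of `C(ℤ_s)`: `𝔞_V f (x) = f (x / s)` if `s ∣ x`, and `0` otherwise. -/
def aV (s : ℕ) [s.AtLeastTwo] : C(SAdicInt s, ℂ) →⋆ₙₐ[ℂ] C(SAdicInt s, ℂ) where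
  toFun f := ⟨aFun f, continuous_aFun f.continuous⟩
  map_smul' r f := by
    ext x
    refine aFun_cases (p := fun x => aFun (r • f) x = r • aFun f x) ?_ ?_ x
    · intro y; rw [aFun_mul, aFun_mul]; rfl
    · intro x hx; rw [aFun_of_not_dvd _ hx, aFun_of_not_dvd _ hx, smul_zero]
  map_zero' := by
    ext x
    refine aFun_cases (p := fun x => aFun (0 : C(SAdicInt s, ℂ)) x = 0) ?_ ?_ x
    · intro y; rw [aFun_mul]; rfl
    · intro x hx; rw [aFun_of_not_dvd _ hx]
  map_add' f g := by
    ext x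
    refine aFun_cases (p := fun x => aFun (f + g) x = aFun f x + aFun g x) ?_ ?_ x
    · intro y; rw [aFun_mul, aFun_mul, aFun_mul]; rfl
    · intro x hx
      rw [aFun_of_not_dvd _ hx, aFun_of_not_dvd _ hx, aFun_of_not_dvd _ hx, add_zero]
  map_mul' f g := by
    ext x
    refine aFun_cases (p := fun x => aFun (f * g) x = aFun f x * aFun g x) ?_ ?_ x
    · intro y; rw [aFun_mul, aFun_mul, aFun_mul]; rfl
    · intro x hx
      rw [aFun_of_not_dvd _ hx, aFun_of_not_dvd _ hx, zero_mul]
  map_star' f := by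
    ext x
    refine aFun_cases (p := fun x => aFun (star f : C(SAdicInt s, ℂ)) x = star (aFun f x)) ?_ ?_ x
    · intro y; rw [aFun_mul, aFun_mul]; rfl
    · intro x hx; rw [aFun_of_not_dvd _ hx, aFun_of_not_dvd _ hx, star_zero]

theorem aV_apply [s.AtLeastTwo] (f : C(SAdicInt s, ℂ)) (x : SAdicInt s) : aV s f x = aFun f x := rfl

end SAdicInt

end SAdic

/-! ### The Hensel shift algebra -/

noncomputable section Hensel

open SAdicInt

variable (s : ℕ)

/-- The vertices `(n, x)`, `0 ≤ x < s ^ n`, of the `s`-adic tree. -/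
abbrev TreeVertex (s : ℕ) : Type := Σ n : ℕ, Fin (s ^ n)

/-- The Hilbert space `ℓ²` of the vertices. -/
abbrev TreeHilbert (s : ℕ) : Type := lp (fun _ : TreeVertex s => ℂ) 2

open Classical in
/-- The canonical basis vectors `E_(n, x)`. -/
def basisVec {s : ℕ} (v : TreeVertex s) : TreeHilbert s := lp.single 2 v (1 : ℂ)

/-- The map `(n, x) ↦ (n + 1, s x)` on vertices. -/
def henselMap [s.AtLeastTwo] (v : TreeVertex s) : TreeVertex s :=
  ⟨v.1 + 1, ⟨s * v.2, by
    rw [pow_succ']; exact Nat.mul_lt_mul_of_pos_left v.2.isLt (NeZero.pos s)⟩⟩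

theorem henselMap_injective [s.AtLeastTwo] : Function.Injective (henselMap s) := by
  rintro ⟨n, x⟩ ⟨m, y⟩ h
  obtain rfl : n = m := by
    have := congrArg Sigma.fst h
    simpa [henselMap] using this
  have h2 := eq_of_heq (Sigma.mk.inj h).2
  have h3 : s * (x : ℕ) = s * y := congrArg Fin.val h2
  have h4 : x = y := Fin.ext (Nat.eq_of_mul_eq_mul_left (NeZero.pos s) h3)
  rw [h4]

theorem orthonormal_basisVec (s : ℕ) : Orthonormal ℂ (basisVec (s := s)) := by
  classical
  rw [orthonormal_iff_ite]
  intro v w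
  rw [basisVec, basisVec, lp.inner_single_left, lp.single_apply]
  by_cases h : v = w
  · subst h; simp
  · simp [h]

/-- The Hensel shift: the isometry with `V E_(n, x) = E_(n + 1, s x)`. -/
def henselShift [s.AtLeastTwo] : TreeHilbert s →L[ℂ] TreeHilbert s :=
  (((orthonormal_basisVec s).comp _ (henselMap_injective s)).orthogonalFamily.linearIsometry
    ).toContinuousLinearMap

theorem henselShift_basisVec [s.AtLeastTwo] (v : TreeVertex s) :
    henselShift s (basisVec v) = basisVec (henselMap s v) := by
  classical
  have := ((orthonormal_basisVec s).comp _
    (henselMap_injective s)).orthogonalFamily.linearIsometry_apply_single (i := v) (1 : ℂ)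
  unfold henselShift
  rw [basisVec]
  refine Eq.trans ?_ (this.trans ?_)
  · congr!
  · simp

/-- The bounded operator `M_f`, with `M_f E_(n, x) = f x • E_(n, x)`. -/
def mulOp [s.AtLeastTwo] (f : C(SAdicInt s, ℂ)) : TreeHilbert s →L[ℂ] TreeHilbert s :=
  have hle : ∀ (ψ : TreeHilbert s) (v : TreeVertex s),
      ‖f ((v.2 : ℕ) : SAdicInt s) * ψ v‖ ≤ ‖((‖f‖ : ℂ) • ψ) v‖ := fun ψ v => by
    rw [lp.coeFn_smul, Pi.smul_apply, norm_smul, norm_mul, Complex.norm_real, norm_norm]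
    exact mul_le_mul_of_nonneg_right (f.norm_coe_le_norm _) (norm_nonneg _)
  LinearMap.mkContinuous
    { toFun := fun ψ => ⟨fun v => f ((v.2 : ℕ) : SAdicInt s) * ψ v,
        (lp.memℓp ((‖f‖ : ℂ) • ψ)).mono' (hle ψ)⟩
      map_add' := fun φ ψ => by ext v; exact mul_add _ _ _
      map_smul' := fun r ψ => by ext v; exact mul_left_comm _ _ _ }
    ‖f‖ (fun ψ => by
      have h2 : (0 : ℝ) < (2 : ENNReal).toReal := by norm_num
      refine lp.norm_le_of_forall_sum_le h2 (by positivity) fun S => ?_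
      calc _ ≤ ∑ v ∈ S, ‖((‖f‖ : ℂ) • ψ) v‖ ^ (2 : ENNReal).toReal :=
            Finset.sum_le_sum fun v _ =>
              Real.rpow_le_rpow (norm_nonneg _) (hle ψ v) h2.le
        _ ≤ ‖(‖f‖ : ℂ) • ψ‖ ^ (2 : ENNReal).toReal := lp.sum_rpow_le_norm_rpow h2 _ S
        _ = _ := by rw [norm_smul, Complex.norm_real, norm_norm])

theorem mulOp_apply [s.AtLeastTwo] (f : C(SAdicInt s, ℂ)) (ψ : TreeHilbert s) (v : TreeVertex s) :
    mulOp s f ψ v = f ((v.2 : ℕ) : SAdicInt s) * ψ v := rfl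

theorem mulOp_basisVec [s.AtLeastTwo] (f : C(SAdicInt s, ℂ)) (v : TreeVertex s) :
    mulOp s f (basisVec v) = f ((v.2 : ℕ) : SAdicInt s) • basisVec v := by
  classical
  ext w
  rw [mulOp_apply, lp.coeFn_smul, Pi.smul_apply, smul_eq_mul, basisVec, lp.single_apply]
  by_cases h : w = v
  · subst h; rfl
  · simp [h]

/-- The Hensel shift algebra `A_V = C*(V, M_f : f ∈ C(ℤ_s))`. -/
def HenselAlgebra [s.AtLeastTwo] : StarSubalgebra ℂ (TreeHilbert s →L[ℂ] TreeHilbert s) :=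
  (StarAlgebra.adjoin ℂ ({henselShift s} ∪ Set.range (mulOp s))).topologicalClosure

end Hensel

/-! ### The space `X_V` and the endomorphism of `C(X_V)` -/

noncomputable section Spectrum

open SAdicInt

/-- The subspace `X_V = {(x, 0) : x ∈ ℤ_s} ∪ {(0, 1 / (n + 1)) : n ≥ 0}` of `ℤ_s × [0, 1]`,
with `[0, 1]` inside `ℝ`. -/
def XV (s : ℕ) : Set (SAdicInt s × ℝ) :=
  {p | ∃ x : SAdicInt s, p = (x, 0)} ∪ {p | ∃ n : ℕ, p = (0, 1 / ((n : ℝ) + 1))}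

namespace XV

variable {s : ℕ}

/-- The point `(x, 0)`. -/
def base (x : SAdicInt s) : XV s := ⟨(x, 0), Or.inl ⟨x, rfl⟩⟩

/-- The point `(0, 1 / (n + 1))`. -/
def spike (s : ℕ) (n : ℕ) : XV s := ⟨(0, 1 / ((n : ℝ) + 1)), Or.inr ⟨n, rfl⟩⟩

theorem eq_base_or_spike (p : XV s) : (∃ x, p = base x) ∨ ∃ n, p = spike s n := by
  obtain ⟨p, ⟨x, rfl⟩ | ⟨n, rfl⟩⟩ := p
  · exact Or.inl ⟨x, rfl⟩
  · exact Or.inr ⟨n, rfl⟩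

theorem continuous_base : Continuous (base : SAdicInt s → XV s) :=
  (continuous_id.prodMk continuous_const).subtype_mk _

theorem tendsto_spike : Tendsto (spike s) atTop (𝓝 (base 0)) := by
  rw [tendsto_subtype_rng]
  exact tendsto_const_nhds.prodMk_nhds tendsto_one_div_add_atTop_nhds_zero_nat

/-- `X_V` as a quotient of the disjoint union of `ℤ_s` and the one-point compactification of `ℕ`. -/
def cover (s : ℕ) : SAdicInt s ⊕ OnePoint ℕ → XV s :=
  Sum.elim base fun t => t.elim (base 0) (spike s)

theorem continuous_cover : Continuous (cover s) := by
  refine continuous_base.sumElim ?_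
  rw [OnePoint.continuous_iff_from_nat]
  exact tendsto_spike

theorem surjective_cover : Function.Surjective (cover s) := by
  intro p
  obtain ⟨x, rfl⟩ | ⟨n, rfl⟩ := eq_base_or_spike p
  · exact ⟨Sum.inl x, rfl⟩
  · exact ⟨Sum.inr (n : OnePoint ℕ), rfl⟩

instance [s.AtLeastTwo] : CompactSpace (XV s) :=
  surjective_cover.compactSpace continuous_cover

theorem continuous_of [s.AtLeastTwo] {G : XV s → ℂ} (h1 : Continuous fun x => G (base x))
    (h2 : Tendsto (fun n => G (spike s n)) atTop (𝓝 (G (base 0)))) : Continuous G := by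
  have hq : IsQuotientMap (cover s) :=
    continuous_cover.isClosedMap.isQuotientMap continuous_cover surjective_cover
  rw [hq.continuous_iff]
  refine continuous_sum_dom.mpr ⟨h1, ?_⟩
  rw [OnePoint.continuous_iff_from_nat]
  exact h2

/-- The function with value `f x` at `(x, 0)` and `u n` at `(0, 1 / (n + 1))`. -/
def glueFun (f : SAdicInt s → ℂ) (u : ℕ → ℂ) (p : XV s) : ℂ :=
  if p.1.2 = 0 then f p.1.1 else u (⌊p.1.2⁻¹⌋₊ - 1)

theorem glueFun_base (f : SAdicInt s → ℂ) (u : ℕ → ℂ) (x : SAdicInt s) :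
    glueFun f u (base x) = f x := if_pos rfl

theorem glueFun_spike (f : SAdicInt s → ℂ) (u : ℕ → ℂ) (n : ℕ) :
    glueFun f u (spike s n) = u n := by
  have h : (1 / ((n : ℝ) + 1)) ≠ 0 := by positivity
  refine (if_neg h).trans ?_
  have h2 : ⌊(1 / ((n : ℝ) + 1))⁻¹⌋₊ = n + 1 := by
    rw [one_div, inv_inv]
    exact_mod_cast Nat.floor_natCast (R := ℝ) (n + 1)
  change u (⌊(1 / ((n : ℝ) + 1))⁻¹⌋₊ - 1) = u n
  rw [h2, Nat.add_sub_cancel]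

/-- The component `f` of `F = (f, (x_n))` in `C(X_V)`. -/
def fstPart (F : C(XV s, ℂ)) : C(SAdicInt s, ℂ) := F.comp ⟨base, continuous_base⟩

/-- The component `(x_n)` of `F = (f, (x_n))` in `C(X_V)`. -/
def sndPart (F : C(XV s, ℂ)) (n : ℕ) : ℂ := F (spike s n)

/-- The shift `(x_n) ↦ (x_(n - 1))` of sequences, with `x_(-1) = 0`. -/
def shift (u : ℕ → ℂ) : ℕ → ℂ
  | 0 => 0
  | n + 1 => u n

theorem continuous_alphaV [s.AtLeastTwo] (F : C(XV s, ℂ)) :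
    Continuous (glueFun (aV s (fstPart F)) (shift (sndPart F))) := by
  refine continuous_of ?_ ?_
  · simp only [glueFun_base]
    exact (aV s (fstPart F)).continuous
  · simp only [glueFun_spike, glueFun_base]
    rw [← tendsto_add_atTop_iff_nat 1]
    have h0 : aV s (fstPart F) 0 = F (base 0) := by
      have := aFun_mul (fstPart F) (0 : SAdicInt s)
      rwa [mul_zero] at this
    rw [h0]
    exact (F.continuous.tendsto _).comp tendsto_spike

/-- The endomorphism `α̃_V (f, (x_n)) = (𝔞_V f, (x_(n - 1)))` of `C(X_V)`. -/
def alphaV (s : ℕ) [s.AtLeastTwo] : C(XV s, ℂ) →⋆ₙₐ[ℂ] C(XV s, ℂ) where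
  toFun F := ⟨glueFun (aV s (fstPart F)) (shift (sndPart F)), continuous_alphaV F⟩
  map_smul' r F := by
    ext p
    obtain ⟨x, rfl⟩ | ⟨n, rfl⟩ := eq_base_or_spike p
    · exact (glueFun_base _ _ x).trans
        ((DFunLike.congr_fun (map_smul (aV s) r (fstPart F)) x).trans
          (congrArg (r • ·) (glueFun_base _ _ x).symm))
    · refine (glueFun_spike _ _ n).trans (Eq.trans ?_ (congrArg (r • ·) (glueFun_spike _ _ n).symm))
      cases n
      · exact (smul_zero r).symm
      · rfl
  map_zero' := by
    ext p
    obtain ⟨x, rfl⟩ | ⟨n, rfl⟩ := eq_base_or_spike p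
    · exact (glueFun_base _ _ x).trans (DFunLike.congr_fun (map_zero (aV s)) x)
    · refine (glueFun_spike _ _ n).trans ?_
      cases n <;> rfl
  map_add' F G := by
    ext p
    obtain ⟨x, rfl⟩ | ⟨n, rfl⟩ := eq_base_or_spike p
    · exact (glueFun_base _ _ x).trans
        ((DFunLike.congr_fun (map_add (aV s) (fstPart F) (fstPart G)) x).trans
          (congrArg₂ (· + ·) (glueFun_base _ _ x).symm (glueFun_base _ _ x).symm))
    · refine (glueFun_spike _ _ n).trans (Eq.trans ?_
        (congrArg₂ (· + ·) (glueFun_spike _ _ n).symm (glueFun_spike _ _ n).symm))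
      cases n
      · exact (add_zero (0 : ℂ)).symm
      · rfl
  map_mul' F G := by
    ext p
    obtain ⟨x, rfl⟩ | ⟨n, rfl⟩ := eq_base_or_spike p
    · exact (glueFun_base _ _ x).trans
        ((DFunLike.congr_fun (map_mul (aV s) (fstPart F) (fstPart G)) x).trans
          (congrArg₂ (· * ·) (glueFun_base _ _ x).symm (glueFun_base _ _ x).symm))
    · refine (glueFun_spike _ _ n).trans (Eq.trans ?_
        (congrArg₂ (· * ·) (glueFun_spike _ _ n).symm (glueFun_spike _ _ n).symm))
      cases n
      · exact (mul_zero (0 : ℂ)).symm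
      · rfl
  map_star' F := by
    ext p
    obtain ⟨x, rfl⟩ | ⟨n, rfl⟩ := eq_base_or_spike p
    · exact (glueFun_base _ _ x).trans
        ((DFunLike.congr_fun (map_star (aV s) (fstPart F)) x).trans
          (congrArg star (glueFun_base _ _ x).symm))
    · refine (glueFun_spike _ _ n).trans (Eq.trans ?_ (congrArg star (glueFun_spike _ _ n).symm))
      cases n
      · exact (star_zero ℂ).symm
      · rfl

theorem alphaV_base [s.AtLeastTwo] (F : C(XV s, ℂ)) (x : SAdicInt s) :
    alphaV s F (base x) = aV s (fstPart F) x := glueFun_base _ _ x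

theorem alphaV_spike_zero [s.AtLeastTwo] (F : C(XV s, ℂ)) : alphaV s F (spike s 0) = 0 :=
  glueFun_spike _ _ 0

theorem alphaV_spike_succ [s.AtLeastTwo] (F : C(XV s, ℂ)) (n : ℕ) :
    alphaV s F (spike s (n + 1)) = F (spike s n) := glueFun_spike _ _ (n + 1)

end XV

end Spectrum

/-! Place the vertex `(n, 0)` at the spike point `(0, 1/(n+1))` of `X_V` and every other vertex `(n,
x)` at `(x, 0)`. Evaluating `F` at these points gives diagonal operators `diagOp F` on `H`, and
these form a covariant pair with the Hensel shift (`diagOp_alphaV`). The universal property yields a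
`*`-homomorphism `φ` from the crossed product to the operators on `H`. It remains to see that `φ` is
isometric and that its range is `A_V`.

Isometry. The image of `α` is the whole corner `α(1) C(X_V) α(1)` (`exists_alphaV_eq_corner`), so
every word in the generators reduces to some `a Jⁿ` or `(a Jⁿ)*`. The operator `diagOp a * Vⁿ`
raises levels by exactly `n`, so a single matrix entry of `φ x` isolates a single coefficient of
`x`, at exactly the points that determine `‖a Jⁿ‖` (`norm_coeff_le_of_decomposition`,
`norm_monomial_le`). The triangle inequality then gives `‖x‖ ≤ 2(N+1)‖φ x‖` in degree at most `N`.
Applied to `(x* x)^(2^j)`, whose degree is linear in `2^j`, and after taking `2^j`-th roots, the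
constant tends to `1` (`norm_le_norm_map_of_linear_bound`).

Range. The functions `F` with `diagOp F ∈ A_V` form a closed `*`-subalgebra. It contains the
functions `f(x)`, which give `M_f`, and the functions `αⁿ(1)`, which give `Vⁿ V*ⁿ`; the latter
separate the spike points, so Stone–Weierstrass applies (`diagOp_mem`). -/

/-! ### Polynomials of bounded degree in a covariant pair -/

namespace CovariantPair

variable {A : Type u} [CStarAlgebra A] {α : A →⋆ₙₐ[ℂ] A} {B : Type v} [CStarAlgebra B]
  (c : CovariantPair α B)

theorem J_mul_π (a : A) : c.J * c.π a = c.π (α a) * c.J := by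
  rw [c.covariant, mul_assoc, c.isometry, mul_one]

theorem J_pow_mul_π (n : ℕ) (a : A) : c.J ^ n * c.π a = c.π (α^[n] a) * c.J ^ n := by
  induction n with
  | zero => simp
  | succ n ih =>
    rw [pow_succ', mul_assoc, ih, ← mul_assoc, J_mul_π, Function.iterate_succ_apply', mul_assoc]

/-- The range projection of `Jⁿ` is itself a coefficient. Hence products `Jᵐ J*ᵏ` simplify and norms
of monomials can be estimated inside `A`. -/
theorem J_pow_mul_star (n : ℕ) : c.J ^ n * star (c.J ^ n) = c.π (α^[n] 1) := by
  induction n with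
  | zero => simp
  | succ n ih =>
    rw [Function.iterate_succ_apply', c.covariant, ← ih, pow_succ', star_mul]
    simp only [mul_assoc]

/-- Compression by the isometry maps coefficients to coefficients, when `α` is onto its corner. -/
theorem exists_compression (hα : ∀ a, ∃ b, α b = α 1 * a * α 1) (n : ℕ) (a : A) :
    ∃ b, star (c.J ^ n) * c.π a * c.J ^ n = c.π b := by
  induction n generalizing a with
  | zero => exact ⟨a, by simp⟩
  | succ n ih =>
    obtain ⟨b, hb⟩ := hα a
    obtain ⟨d, hd⟩ := ih b
    refine ⟨d, ?_⟩
    -- Since `π(α 1) = J J*`, the choice of `b` reads `J π(b) J* = J J* π(a) J J*`; compressing by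
    -- `J*` and `J` cancels the outer isometries.
    have h1 : star c.J * c.π a * c.J = c.π b := by
      have hP : c.π (α 1) = c.J * star c.J := by rw [c.covariant, map_one, mul_one]
      have h2 := congrArg c.π hb
      rw [map_mul, map_mul, hP, c.covariant] at h2
      have h3 := congrArg (fun t => star c.J * t * c.J) h2
      simp only [mul_assoc, c.isometry, mul_one] at h3
      simp only [← mul_assoc, c.isometry, one_mul] at h3
      exact h3.symm
    rw [← hd, ← h1, pow_succ', star_mul]
    simp only [mul_assoc]

/-- The elements `a Jⁿ` and `(a Jⁿ)*` with `n ≤ N`. -/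
def monomials (N : ℕ) : Set B :=
  {x | ∃ n ≤ N, ∃ a, x = c.π a * c.J ^ n ∨ x = star (c.π a * c.J ^ n)}

/-- The linear span of the elements `a Jⁿ` and `(a Jⁿ)*` with `n ≤ N`. -/
noncomputable def degreeLE (N : ℕ) : Submodule ℂ B := Submodule.span ℂ (c.monomials N)

variable {c}

theorem star_mem_monomials {N : ℕ} {x : B} (hx : x ∈ c.monomials N) :
    star x ∈ c.monomials N := by
  obtain ⟨n, h, a, rfl | rfl⟩ := hx
  · exact ⟨n, h, a, Or.inr rfl⟩
  · exact ⟨n, h, a, Or.inl (star_star _)⟩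

theorem of_star_mem_monomials {N : ℕ} {x : B} (hx : star x ∈ c.monomials N) :
    x ∈ c.monomials N := by
  simpa using star_mem_monomials hx

theorem degreeLE_mono : Monotone c.degreeLE := fun _ _ hNM =>
  Submodule.span_mono fun _ ⟨n, h, hx⟩ => ⟨n, h.trans hNM, hx⟩

theorem star_mem_degreeLE {N : ℕ} {x : B} (hx : x ∈ c.degreeLE N) : star x ∈ c.degreeLE N := by
  induction hx using Submodule.span_induction with
  | mem x h => exact Submodule.subset_span (star_mem_monomials h)
  | zero => rw [star_zero]; exact zero_mem _
  | add x y _ _ hx hy => rw [star_add]; exact add_mem hx hy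
  | smul r x _ hx => rw [star_smul]; exact Submodule.smul_mem _ _ hx

theorem mul_mem_monomials_aux (a b : A) (m k : ℕ) :
    (c.π a * c.J ^ m) * (c.π b * c.J ^ k) ∈ c.monomials (m + k) := by
  refine ⟨m + k, le_rfl, a * α^[m] b, Or.inl ?_⟩
  rw [mul_assoc, ← mul_assoc (c.J ^ m), J_pow_mul_π, map_mul, pow_add]
  simp only [mul_assoc]

/-- With `m = j + k`, `Jᵐ J*ᵏ = Jʲ (Jᵏ J*ᵏ)`. The bracket is a coefficient, which moves to the left
of `Jʲ` at the price of applying `αʲ`. -/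
theorem mul_star_mem_monomials_of_le (a b : A) {m k : ℕ} (h : k ≤ m) :
    (c.π a * c.J ^ m) * star (c.π b * c.J ^ k) ∈ c.monomials (m + k) := by
  obtain ⟨j, rfl⟩ := Nat.exists_eq_add_of_le' h
  refine ⟨j, by omega, a * α^[j] (α^[k] 1 * star b), Or.inl ?_⟩
  rw [map_mul, mul_assoc (c.π a) (c.π _), ← J_pow_mul_π, map_mul, ← J_pow_mul_star, map_star,
    star_mul, pow_add]
  simp only [mul_assoc]

theorem mul_star_mem_monomials (a b : A) (m k : ℕ) :
    (c.π a * c.J ^ m) * star (c.π b * c.J ^ k) ∈ c.monomials (m + k) := by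
  rcases le_total k m with h | h
  · exact mul_star_mem_monomials_of_le a b h
  · refine of_star_mem_monomials ?_
    rw [star_mul, star_star, add_comm]
    exact mul_star_mem_monomials_of_le b a h

/-- With `k = m + j`, the middle of the product is a compression `J*ᵐ π(·) Jᵐ`, hence a coefficient,
and `Jʲ` is left over. This is where the corner condition on `α` enters the reduction of words. -/
theorem star_mul_mem_monomials_of_le (hα : ∀ a, ∃ b, α b = α 1 * a * α 1) (a b : A) {m k : ℕ}
    (h : m ≤ k) : star (c.π a * c.J ^ m) * (c.π b * c.J ^ k) ∈ c.monomials (m + k) := by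
  obtain ⟨j, rfl⟩ := Nat.exists_eq_add_of_le h
  obtain ⟨d, hd⟩ := c.exists_compression hα m (star a * b)
  refine ⟨j, by omega, d, Or.inl ?_⟩
  rw [← hd, map_mul, map_star, star_mul, pow_add]
  simp only [mul_assoc]

theorem star_mul_mem_monomials (hα : ∀ a, ∃ b, α b = α 1 * a * α 1) (a b : A) (m k : ℕ) :
    star (c.π a * c.J ^ m) * (c.π b * c.J ^ k) ∈ c.monomials (m + k) := by
  rcases le_total m k with h | h
  · exact star_mul_mem_monomials_of_le hα a b h
  · refine of_star_mem_monomials ?_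
    rw [star_mul, star_star, add_comm]
    exact star_mul_mem_monomials_of_le hα b a h

theorem monomials_mono : Monotone c.monomials := fun _ _ hNM _ ⟨n, h, hx⟩ => ⟨n, h.trans hNM, hx⟩

theorem mul_mem_monomials (hα : ∀ a, ∃ b, α b = α 1 * a * α 1) {N M : ℕ} {x y : B}
    (hx : x ∈ c.monomials N) (hy : y ∈ c.monomials M) : x * y ∈ c.monomials (N + M) := by
  obtain ⟨n, hn, a, hx⟩ := hx
  obtain ⟨m, hm, b, hy⟩ := hy
  refine monomials_mono (add_le_add hn hm) ?_
  rcases hx with rfl | rfl <;> rcases hy with rfl | rfl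
  · exact mul_mem_monomials_aux a b n m
  · exact mul_star_mem_monomials a b n m
  · exact star_mul_mem_monomials hα a b n m
  · refine of_star_mem_monomials ?_
    rw [star_mul, star_star, star_star, add_comm]
    exact mul_mem_monomials_aux b a m n

theorem mul_mem_degreeLE (hα : ∀ a, ∃ b, α b = α 1 * a * α 1) {N M : ℕ} {x y : B}
    (hx : x ∈ c.degreeLE N) (hy : y ∈ c.degreeLE M) : x * y ∈ c.degreeLE (N + M) := by
  have h : c.degreeLE N * c.degreeLE M ≤ c.degreeLE (N + M) := by
    rw [degreeLE, degreeLE, Submodule.span_mul_span, Submodule.span_le]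
    rintro _ ⟨x, hx, y, hy, rfl⟩
    exact Submodule.subset_span (mul_mem_monomials hα hx hy)
  exact h (Submodule.mul_mem_mul hx hy)

theorem one_mem_degreeLE (N : ℕ) : (1 : B) ∈ c.degreeLE N :=
  Submodule.subset_span ⟨0, N.zero_le, 1, Or.inl (by simp)⟩

/-- The degree grows only linearly with the exponent, so a norm estimate with constant linear in the
degree survives the extraction of high roots. -/
theorem pow_mem_degreeLE (hα : ∀ a, ∃ b, α b = α 1 * a * α 1) {N : ℕ} {x : B}
    (hx : x ∈ c.degreeLE N) (k : ℕ) : x ^ k ∈ c.degreeLE (N * k) := by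
  induction k with
  | zero => rw [pow_zero]; exact one_mem_degreeLE _
  | succ k ih => rw [pow_succ, Nat.mul_succ]; exact mul_mem_degreeLE hα ih hx

theorem exists_mem_degreeLE (hα : ∀ a, ∃ b, α b = α 1 * a * α 1) (x : CrossedPoly α) :
    ∃ N, c.eval x ∈ c.degreeLE N := by
  have hJ : c.J ∈ c.monomials 1 := ⟨1, le_rfl, 1, Or.inl (by simp)⟩
  induction x using CrossedPoly.induction with
  | scalar r =>
    refine ⟨0, ?_⟩
    rw [AlgHom.commutes, Algebra.algebraMap_eq_smul_one]
    exact Submodule.smul_mem _ _ (one_mem_degreeLE _)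
  | gen g =>
    cases g with
    | coeff a =>
      refine ⟨0, ?_⟩
      rw [c.eval_coeff]
      exact Submodule.subset_span ⟨0, le_rfl, a, Or.inl (by simp)⟩
    | iso => exact ⟨1, by rw [c.eval_iso]; exact Submodule.subset_span hJ⟩
    | isoStar =>
      exact ⟨1, by rw [c.eval_isoStar]; exact Submodule.subset_span (star_mem_monomials hJ)⟩
  | mul x y hx hy =>
    obtain ⟨N, hx⟩ := hx
    obtain ⟨M, hy⟩ := hy
    exact ⟨N + M, by rw [map_mul]; exact mul_mem_degreeLE hα hx hy⟩
  | add x y hx hy =>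
    obtain ⟨N, hx⟩ := hx
    obtain ⟨M, hy⟩ := hy
    refine ⟨N + M, ?_⟩
    rw [map_add]
    exact add_mem (degreeLE_mono (by omega) hx) (degreeLE_mono (by omega) hy)

/-- An element of degree at most `N` is the sum of an analytic and a coanalytic polynomial, the
latter without constant term. -/
theorem exists_coeffs {N : ℕ} {x : B} (hx : x ∈ c.degreeLE N) :
    ∃ a b : ℕ → A, b 0 = 0 ∧ x = ∑ n ∈ Finset.range (N + 1), c.π (a n) * c.J ^ n +
      star (∑ n ∈ Finset.range (N + 1), c.π (b n) * c.J ^ n) := by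
  classical
  have hs : ∀ n ≤ N, ∀ a : A, ∑ i ∈ Finset.range (N + 1),
      c.π ((Pi.single n a : ℕ → A) i) * c.J ^ i = c.π a * c.J ^ n := fun n hn a => by
    rw [Finset.sum_eq_single_of_mem n (Finset.mem_range.mpr (by omega))]
    · rw [Pi.single_eq_same]
    · intro i _ hi
      rw [Pi.single_eq_of_ne hi, map_zero, zero_mul]
  induction hx using Submodule.span_induction with
  | mem x h =>
    obtain ⟨n, hn, a, rfl | rfl⟩ := h
    · exact ⟨Pi.single n a, 0, rfl, by rw [hs n hn]; simp⟩
    -- In degree `0` the starred monomial is again a coefficient. It is booked in the analytic part,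
    -- which keeps `b 0 = 0`.
    · rcases Nat.eq_zero_or_pos n with rfl | h0
      · refine ⟨Pi.single 0 (star a), 0, rfl, ?_⟩
        rw [hs 0 hn]; simp [map_star]
      · refine ⟨0, Pi.single n a, Pi.single_eq_of_ne h0.ne _, ?_⟩
        rw [hs n hn]; simp
  | zero => exact ⟨0, 0, rfl, by simp⟩
  | add x y _ _ hx hy =>
    obtain ⟨a, b, hb, rfl⟩ := hx
    obtain ⟨a', b', hb', rfl⟩ := hy
    refine ⟨a + a', b + b', by simp [hb, hb'], ?_⟩
    simp only [Pi.add_apply, map_add, add_mul, Finset.sum_add_distrib, star_add]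
    abel
  | smul r x _ hx =>
    obtain ⟨a, b, hb, rfl⟩ := hx
    refine ⟨r • a, star r • b, by simp [hb], ?_⟩
    simp only [Pi.smul_apply, map_smul, smul_mul_assoc, ← Finset.smul_sum, star_smul, star_star,
      smul_add]

/-- By the C*-identity the square of the norm is that of `π(a) Jⁿ J*ⁿ π(a)*`, a coefficient. The
resulting bound lives in `A` and is independent of the covariant pair. -/
theorem norm_monomial_sq (a : A) (n : ℕ) :
    ‖c.π a * c.J ^ n‖ * ‖c.π a * c.J ^ n‖ ≤ ‖a * α^[n] 1 * star a‖ := by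
  rw [← CStarRing.norm_self_mul_star, star_mul, mul_assoc, ← mul_assoc (c.J ^ n), J_pow_mul_star,
    ← map_star, ← map_mul, ← map_mul, ← mul_assoc]
  exact NonUnitalStarAlgHom.norm_apply_le c.π _

end CovariantPair

/-! ### From linear bounds to isometry -/

/-- If `q < r`, the geometric decay of `(q/r)^n` beats the factor `n` along `n = 2^j`, and the
hypothesis becomes `1 ≤ 0` in the limit. -/
theorem le_of_forall_pow_two_pow_le {r q K : ℝ} (hr : 0 ≤ r) (hq : 0 ≤ q)
    (h : ∀ j : ℕ, r ^ 2 ^ j ≤ K * 2 ^ j * q ^ 2 ^ j) : r ≤ q := by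
  by_contra! hlt
  have hr0 : 0 < r := hq.trans_lt hlt
  have h1 : ∀ j : ℕ, 1 ≤ K * (((2 ^ j : ℕ) : ℝ) * (q / r) ^ 2 ^ j) := fun j => by
    have hp : 0 < r ^ 2 ^ j := pow_pos hr0 _
    rw [div_pow, ← mul_div_assoc, ← mul_div_assoc, le_div_iff₀ hp, one_mul, ← mul_assoc]
    push_cast
    exact h j
  have h2 : Tendsto (fun n : ℕ => (n : ℝ) * (q / r) ^ n) atTop (𝓝 0) :=
    tendsto_self_mul_const_pow_of_lt_one (div_nonneg hq hr) ((div_lt_one hr0).mpr hlt)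
  have h3 := ((h2.comp (tendsto_pow_atTop_atTop_of_one_lt (one_lt_two (α := ℕ)))).const_mul K)
  rw [mul_zero] at h3
  exact absurd (ge_of_tendsto' h3 h1) (by norm_num)

theorem norm_star_mul_self_pow_two_pow {E : Type u} [CStarAlgebra E] (y : E) (j : ℕ) :
    ‖(star y * y) ^ 2 ^ j‖ = (‖y‖ * ‖y‖) ^ 2 ^ j := by
  have := congrArg NNReal.toReal ((IsSelfAdjoint.star_mul_self y).nnnorm_pow_two_pow j)
  simpa [CStarRing.norm_star_mul_self] using this

/-- A `*`-homomorphism that is bounded below on polynomials, with constants growing linearly in the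
degree, is isometric on polynomials. -/
theorem CovariantPair.norm_le_norm_map_of_linear_bound {A : Type u} [CStarAlgebra A]
    {α : A →⋆ₙₐ[ℂ] A} {B : Type u} [CStarAlgebra B] {c : CovariantPair α B}
    {C : Type v} [CStarAlgebra C] (φ : B →⋆ₐ[ℂ] C)
    (hα : ∀ a, ∃ b, α b = α 1 * a * α 1)
    (hφ : ∀ N, ∀ x ∈ c.degreeLE N, ‖x‖ ≤ 2 * ((N : ℝ) + 1) * ‖φ x‖)
    {N : ℕ} {x : B} (hx : x ∈ c.degreeLE N) : ‖x‖ ≤ ‖φ x‖ := by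
  refine abs_le_of_sq_le_sq' ?_ (norm_nonneg _) |>.2
  rw [sq, sq]
  -- The element `(x* x)^(2^j)` has degree at most `2N·2^j`, and `2(2N·2^j + 1) ≤ 2(2N + 1)·2^j`;
  -- this gives `K`.
  refine le_of_forall_pow_two_pow_le (K := 2 * ((N : ℝ) + N + 1))
    (mul_self_nonneg _) (mul_self_nonneg _) fun j => ?_
  have hmem := pow_mem_degreeLE hα (mul_mem_degreeLE hα (star_mem_degreeLE hx) hx) (2 ^ j)
  have h := hφ _ _ hmem
  rw [map_pow, map_mul, map_star, norm_star_mul_self_pow_two_pow,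
    norm_star_mul_self_pow_two_pow] at h
  refine h.trans (mul_le_mul_of_nonneg_right ?_ (pow_nonneg (mul_self_nonneg _) _))
  push_cast
  have : (1 : ℝ) ≤ 2 ^ j := one_le_pow₀ (by norm_num)
  nlinarith

/-! ### The representation of `C(X_V)` by diagonal operators -/

noncomputable section HenselRepresentation

open SAdicInt

namespace XV

variable {s : ℕ}

/-- The point of `X_V` at which functions are evaluated at the vertex `(n, x)`. -/
def point (v : TreeVertex s) : XV s :=
  if (v.2 : ℕ) = 0 then spike s v.1 else base ((v.2 : ℕ) : SAdicInt s)

theorem point_of_eq_zero {v : TreeVertex s} (h : (v.2 : ℕ) = 0) : point v = spike s v.1 := if_pos h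

theorem point_of_ne_zero {v : TreeVertex s} (h : (v.2 : ℕ) ≠ 0) :
    point v = base ((v.2 : ℕ) : SAdicInt s) := if_neg h

theorem point_fst (v : TreeVertex s) : (point v).1.1 = ((v.2 : ℕ) : SAdicInt s) := by
  by_cases h : (v.2 : ℕ) = 0
  · rw [point_of_eq_zero h, h, Nat.cast_zero]; rfl
  · rw [point_of_ne_zero h]; rfl

theorem natCast_coord (k n : ℕ) : ((k : SAdicInt s)).1 n = (k : ZMod (s ^ n)) := by simp

theorem ext_of_basisVec {T S : TreeHilbert s →L[ℂ] TreeHilbert s}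
    (h : ∀ v, T (basisVec v) = S (basisVec v)) : T = S := by
  classical
  ext1 ψ
  have hψ := lp.hasSum_single (p := 2) (by norm_num) ψ
  have hs : ∀ v, lp.single (E := fun _ : TreeVertex s => ℂ) 2 v (ψ v) = ψ v • basisVec v :=
    fun v => by
      ext w
      rw [lp.coeFn_smul, Pi.smul_apply, basisVec, lp.single_apply, lp.single_apply]
      by_cases hw : w = v
      · subst hw; simp
      · simp [hw]
  simp only [hs] at hψ
  have h1 := T.hasSum hψ
  have h2 := S.hasSum hψ
  simp only [map_smul, h] at h1 h2
  exact h1.unique h2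

theorem norm_basisVec (v : TreeVertex s) : ‖basisVec v‖ = 1 := (orthonormal_basisVec s).1 v

theorem norm_inner_basisVec_le (T : TreeHilbert s →L[ℂ] TreeHilbert s) (v w : TreeVertex s) :
    ‖inner ℂ (basisVec v) (T (basisVec w))‖ ≤ ‖T‖ := by
  refine (norm_inner_le_norm _ _).trans ?_
  rw [norm_basisVec, one_mul]
  refine (T.le_opNorm _).trans ?_
  rw [norm_basisVec, mul_one]

/-! ### Density of the vertex points in `X_V` -/

variable [s.AtLeastTwo]

theorem val_mod_pow (x : SAdicInt s) {n m : ℕ} (h : n ≤ m) :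
    (x.1 m).val % s ^ n = (x.1 n).val := by
  induction m, h using Nat.le_induction with
  | base => exact Nat.mod_eq_of_lt (ZMod.val_lt _)
  | succ m hm ih =>
    rw [← ih, ← val_succ_mod x m, Nat.mod_mod_of_dvd _ (pow_dvd_pow s hm)]

theorem tendsto_natCast_val (x : SAdicInt s) :
    Tendsto (fun n => (((x.1 n).val : ℕ) : SAdicInt s)) atTop (𝓝 x) := by
  rw [tendsto_subtype_rng, tendsto_pi_nhds]
  intro n
  refine tendsto_nhds_of_eventually_eq ?_
  filter_upwards [eventually_ge_atTop n] with m hm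
  rw [natCast_coord, ← ZMod.natCast_mod, val_mod_pow x hm, ZMod.natCast_zmod_val]

/-- The vertex of level `n` that approximates an `s`-adic integer. -/
def approx (x : SAdicInt s) (n : ℕ) : TreeVertex s := ⟨n, ⟨(x.1 n).val, ZMod.val_lt _⟩⟩

/-- If `x ≠ 0`, its truncations are eventually nonzero, so the vertices sit at `(x mod sⁿ, 0)`. If
`x = 0`, all of them sit on the spike, which also converges to `(0, 0)`. -/
theorem tendsto_point_approx (x : SAdicInt s) :
    Tendsto (fun n => point (approx x n)) atTop (𝓝 (base x)) := by
  by_cases hx : x = 0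
  · subst hx
    refine tendsto_spike.congr fun n => (point_of_eq_zero (v := approx 0 n) ?_).symm
    exact ZMod.val_zero
  · obtain ⟨n, hn⟩ : ∃ n, x.1 n ≠ 0 := by
      by_contra! h
      exact hx (ext' h)
    have hn' : (x.1 n).val ≠ 0 := fun h => hn ((ZMod.val_eq_zero _).mp h)
    refine ((continuous_base.tendsto x).comp (tendsto_natCast_val x)).congr' ?_
    filter_upwards [eventually_ge_atTop n] with m hm
    refine (point_of_ne_zero (v := approx x m) fun h => hn' ?_).symm
    change (x.1 m).val = 0 at h
    rw [← val_mod_pow x hm, h, Nat.zero_mod]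

/-- The vertex points are dense: spike points are vertex points, and base points are limits of such.
-/
theorem norm_le_of_forall_point {F : C(XV s, ℂ)} {C : ℝ} (h : ∀ v, ‖F (point v)‖ ≤ C) :
    ‖F‖ ≤ C := by
  have hC : 0 ≤ C := (norm_nonneg _).trans (h ⟨0, ⟨0, by simp⟩⟩)
  refine (ContinuousMap.norm_le _ hC).mpr fun p => ?_
  obtain ⟨x, rfl⟩ | ⟨n, rfl⟩ := eq_base_or_spike p
  · exact le_of_tendsto ((F.continuous.norm.tendsto _).comp (tendsto_point_approx x))
      (Eventually.of_forall fun n => h _)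
  · have h0 : 0 < s ^ n := pow_pos (NeZero.pos s) n
    have := h ⟨n, ⟨0, h0⟩⟩
    rwa [point_of_eq_zero rfl] at this

/-! ### The endomorphism at vertex points -/

/-- The map `henselMap` corresponds under `point` to `(x, 0) ↦ (s x, 0)` on nonzero labels and to a
step along the spike on the label `0`. The two cases do not mix, because `s x = 0` only for `x = 0`.
-/
theorem alphaV_point_henselMap (F : C(XV s, ℂ)) (v : TreeVertex s) :
    alphaV s F (point (henselMap s v)) = F (point v) := by
  have hval : ((henselMap s v).2 : ℕ) = s * (v.2 : ℕ) := rfl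
  by_cases h : (v.2 : ℕ) = 0
  · rw [point_of_eq_zero h, point_of_eq_zero (by rw [hval, h, mul_zero])]
    exact alphaV_spike_succ F v.1
  · rw [point_of_ne_zero h, point_of_ne_zero (by
      rw [hval]; exact mul_ne_zero (NeZero.ne s) h), alphaV_base, hval, Nat.cast_mul, aV_apply,
      aFun_mul]
    rfl

/-- The vertices missed are the root and those whose label is not divisible by `s`. The root
explains the spike and the convention `x_(-1) = 0`: over `ℤ_s` alone, `𝔞_V f (0) = f 0` would not
vanish there. -/
theorem alphaV_point_of_notMem (F : C(XV s, ℂ)) {v : TreeVertex s}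
    (hv : v ∉ Set.range (henselMap s)) : alphaV s F (point v) = 0 := by
  obtain ⟨n, x, hx⟩ := v
  rcases n with _ | n
  · have h0 : x = 0 := by simpa using hx
    subst h0
    rw [point_of_eq_zero rfl]
    exact alphaV_spike_zero F
  · have hns : ¬ s ∣ x := by
      rintro ⟨y, rfl⟩
      rw [pow_succ'] at hx
      exact hv ⟨⟨n, ⟨y, lt_of_mul_lt_mul_left hx (Nat.zero_le s)⟩⟩, rfl⟩
    rw [point_of_ne_zero (v := ⟨n + 1, ⟨x, hx⟩⟩) fun h => hns (by
      change x = 0 at h; rw [h]; exact dvd_zero s), alphaV_base, aV_apply]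
    refine aFun_of_not_dvd _ fun h => hns ?_
    rw [dvd_iff, natCast_coord, ZMod.natCast_eq_zero_iff, pow_one] at h
    exact h

theorem alphaV_iterate_point (F : C(XV s, ℂ)) (n : ℕ) (v : TreeVertex s) :
    (alphaV s)^[n] F (point ((henselMap s)^[n] v)) = F (point v) := by
  induction n with
  | zero => rfl
  | succ n ih => rw [Function.iterate_succ_apply', Function.iterate_succ_apply',
      alphaV_point_henselMap, ih]

theorem alphaV_iterate_point_of_notMem (F : C(XV s, ℂ)) (n : ℕ) {v : TreeVertex s}
    (hv : v ∉ Set.range (henselMap s)^[n]) : (alphaV s)^[n] F (point v) = 0 := by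
  induction n generalizing v with
  | zero => exact absurd ⟨v, rfl⟩ hv
  | succ n ih =>
    rw [Function.iterate_succ_apply']
    by_cases h : v ∈ Set.range (henselMap s)
    · obtain ⟨w, rfl⟩ := h
      rw [alphaV_point_henselMap]
      refine ih ?_
      rintro ⟨u, rfl⟩
      exact hv ⟨u, Function.iterate_succ_apply' _ _ _⟩
    · exact alphaV_point_of_notMem _ h

theorem ext_of_point {F G : C(XV s, ℂ)} (h : ∀ v, F (point v) = G (point v)) : F = G := by
  rw [← sub_eq_zero, ← norm_le_zero_iff]
  exact norm_le_of_forall_point fun v => by simp [h v]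

/-- The endomorphism transports functions along the injection `(x, 0) ↦ (s x, 0)`, `spike n ↦ spike
(n + 1)`, and extends them by zero. The required preimage is therefore `F` composed with this
injection. -/
theorem exists_alphaV_eq_corner (F : C(XV s, ℂ)) :
    ∃ G, alphaV s G = alphaV s 1 * F * alphaV s 1 := by
  have hmul : Continuous fun x : SAdicInt s => (s : SAdicInt s) * x :=
    (isOpenEmbedding_mul s).continuous
  let f : SAdicInt s → ℂ := fun x => F (base (s * x))
  let u : ℕ → ℂ := fun n => F (spike s (n + 1))
  have hc : Continuous (glueFun f u) := by
    refine continuous_of ?_ ?_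
    · simp only [glueFun_base]
      exact F.continuous.comp (continuous_base.comp hmul)
    · simp only [glueFun_spike, glueFun_base]
      have h0 : f 0 = F (base 0) := by simp [f]
      rw [h0]
      exact (F.continuous.tendsto _).comp (tendsto_spike.comp (tendsto_add_atTop_nat 1))
  refine ⟨⟨glueFun f u, hc⟩, ext_of_point fun v => ?_⟩
  rw [ContinuousMap.mul_apply, ContinuousMap.mul_apply]
  by_cases hv : v ∈ Set.range (henselMap s)
  · obtain ⟨w, rfl⟩ := hv
    simp only [alphaV_point_henselMap, ContinuousMap.one_apply, one_mul, mul_one,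
      ContinuousMap.coe_mk]
    have hval : ((henselMap s w).2 : ℕ) = s * (w.2 : ℕ) := rfl
    by_cases h : (w.2 : ℕ) = 0
    · rw [point_of_eq_zero h, point_of_eq_zero (by rw [hval, h, mul_zero]), glueFun_spike]
      rfl
    · rw [point_of_ne_zero h, point_of_ne_zero (by
        rw [hval]; exact mul_ne_zero (NeZero.ne s) h), glueFun_base, hval, Nat.cast_mul]
  · rw [alphaV_point_of_notMem _ hv, alphaV_point_of_notMem _ hv, zero_mul, zero_mul]

/-! ### Diagonal operators and their covariance with the Hensel shift -/

/-- The diagonal operator with entry `F (point v)` at the vertex `v`. -/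
def diagOp (F : C(XV s, ℂ)) : TreeHilbert s →L[ℂ] TreeHilbert s :=
  have hle : ∀ (ψ : TreeHilbert s) (v : TreeVertex s),
      ‖F (point v) * ψ v‖ ≤ ‖((‖F‖ : ℂ) • ψ) v‖ := fun ψ v => by
    rw [lp.coeFn_smul, Pi.smul_apply, norm_smul, norm_mul, Complex.norm_real, norm_norm]
    exact mul_le_mul_of_nonneg_right (F.norm_coe_le_norm _) (norm_nonneg _)
  LinearMap.mkContinuous
    { toFun := fun ψ => ⟨fun v => F (point v) * ψ v,
        (lp.memℓp ((‖F‖ : ℂ) • ψ)).mono' (hle ψ)⟩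
      map_add' := fun φ ψ => by ext v; exact mul_add _ _ _
      map_smul' := fun r ψ => by ext v; exact mul_left_comm _ _ _ }
    ‖F‖ (fun ψ => by
      have h2 : (0 : ℝ) < (2 : ENNReal).toReal := by norm_num
      refine lp.norm_le_of_forall_sum_le h2 (by positivity) fun S => ?_
      calc _ ≤ ∑ v ∈ S, ‖((‖F‖ : ℂ) • ψ) v‖ ^ (2 : ENNReal).toReal :=
            Finset.sum_le_sum fun v _ =>
              Real.rpow_le_rpow (norm_nonneg _) (hle ψ v) h2.le
        _ ≤ ‖(‖F‖ : ℂ) • ψ‖ ^ (2 : ENNReal).toReal := lp.sum_rpow_le_norm_rpow h2 _ S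
        _ = _ := by rw [norm_smul, Complex.norm_real, norm_norm])

theorem diagOp_apply (F : C(XV s, ℂ)) (ψ : TreeHilbert s) (v : TreeVertex s) :
    diagOp F ψ v = F (point v) * ψ v := rfl

theorem diagOp_basisVec (F : C(XV s, ℂ)) (v : TreeVertex s) :
    diagOp F (basisVec v) = F (point v) • basisVec v := by
  classical
  ext w
  rw [diagOp_apply, lp.coeFn_smul, Pi.smul_apply, smul_eq_mul, basisVec, lp.single_apply]
  by_cases h : w = v
  · subst h; rfl
  · simp [h]

theorem diagOp_star (F : C(XV s, ℂ)) : diagOp (star F) = star (diagOp F) := by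
  rw [ContinuousLinearMap.star_eq_adjoint, ContinuousLinearMap.eq_adjoint_iff]
  intro φ ψ
  rw [lp.inner_eq_tsum, lp.inner_eq_tsum]
  refine tsum_congr fun v => ?_
  rw [diagOp_apply, diagOp_apply, ContinuousMap.star_apply, RCLike.inner_apply,
    RCLike.inner_apply, map_mul]
  simp only [Complex.star_def, Complex.conj_conj]
  ring

variable (s) in
/-- The representation of `C(X_V)` by diagonal operators. -/
def diagRep : C(XV s, ℂ) →⋆ₐ[ℂ] (TreeHilbert s →L[ℂ] TreeHilbert s) where
  toFun := diagOp
  map_one' := by ext ψ v; exact one_mul _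
  map_mul' F G := by ext ψ v; exact mul_assoc _ _ _
  map_zero' := by ext ψ v; exact zero_mul _
  map_add' F G := by ext ψ v; exact add_mul _ _ _
  commutes' r := by ext ψ v; rfl
  map_star' := diagOp_star

theorem star_henselShift_mul_self : star (henselShift s) * henselShift s = 1 := by
  rw [ContinuousLinearMap.star_eq_adjoint, ContinuousLinearMap.mul_def,
    ContinuousLinearMap.one_def]
  refine (ContinuousLinearMap.norm_map_iff_adjoint_comp_self _).mp fun ψ => ?_
  exact LinearIsometry.norm_map _ ψ

theorem star_henselShift_basisVec {v : TreeVertex s} (hv : v ∉ Set.range (henselMap s)) :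
    star (henselShift s) (basisVec v) = 0 := by
  classical
  ext w
  have h1 := lp.inner_single_left (𝕜 := ℂ) (G := fun _ : TreeVertex s => ℂ) w (1 : ℂ)
    (star (henselShift s) (basisVec v))
  have h2 : inner ℂ (basisVec w) (star (henselShift s) (basisVec v)) = 0 := by
    rw [ContinuousLinearMap.star_eq_adjoint, ContinuousLinearMap.adjoint_inner_right,
      henselShift_basisVec]
    exact (orthonormal_basisVec s).2 fun h => hv ⟨w, h⟩
  rw [basisVec] at h2
  simpa using (h1.symm.trans h2)

/-- Both sides are diagonal. On the range of `henselMap`, `V*` undoes the shift; elsewhere `V*`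
kills the basis vector and `α F` vanishes. -/
theorem diagOp_alphaV (F : C(XV s, ℂ)) :
    diagOp (alphaV s F) = henselShift s * diagOp F * star (henselShift s) := by
  refine ext_of_basisVec fun v => ?_
  rw [diagOp_basisVec, mul_apply_eq_comp, mul_apply_eq_comp]
  by_cases hv : v ∈ Set.range (henselMap s)
  · obtain ⟨w, rfl⟩ := hv
    rw [← henselShift_basisVec, ← mul_apply_eq_comp (star _),
      star_henselShift_mul_self, one_apply_eq_self, diagOp_basisVec, map_smul,
      alphaV_point_henselMap]
  · rw [star_henselShift_basisVec hv, map_zero, map_zero, alphaV_point_of_notMem F hv, zero_smul]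

variable (s) in
/-- The covariant pair of the diagonal representation and the Hensel shift. -/
def henselPair : CovariantPair (alphaV s) (TreeHilbert s →L[ℂ] TreeHilbert s) where
  π := diagRep s
  J := henselShift s
  isometry := star_henselShift_mul_self
  covariant := diagOp_alphaV

/-! ### Matrix coefficients -/

theorem henselShift_pow_basisVec (n : ℕ) (v : TreeVertex s) :
    (henselShift s ^ n) (basisVec v) = basisVec ((henselMap s)^[n] v) := by
  induction n with
  | zero => rfl
  | succ n ih => rw [pow_succ', mul_apply_eq_comp, ih, henselShift_basisVec,
      Function.iterate_succ_apply']

theorem henselMap_iterate_fst (n : ℕ) (v : TreeVertex s) :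
    ((henselMap s)^[n] v).1 = v.1 + n := by
  induction n with
  | zero => rfl
  | succ n ih =>
    rw [Function.iterate_succ_apply']
    change ((henselMap s)^[n] v).1 + 1 = _
    rw [ih, add_assoc]

theorem sum_monomials_basisVec (a : ℕ → C(XV s, ℂ)) (N : ℕ) (v : TreeVertex s) :
    (∑ n ∈ Finset.range N, diagOp (a n) * henselShift s ^ n) (basisVec v) =
      ∑ n ∈ Finset.range N,
        a n (point ((henselMap s)^[n] v)) • basisVec ((henselMap s)^[n] v) := by
  rw [_root_.sum_apply]
  refine Finset.sum_congr rfl fun n _ => ?_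
  rw [mul_apply_eq_comp, henselShift_pow_basisVec, diagOp_basisVec]

/-- The `m`-th summand sends `E_v` to level `v.1 + m`, so distinct summands are orthogonal and one
entry isolates one coefficient. -/
theorem inner_sum_monomials (a : ℕ → C(XV s, ℂ)) {N n : ℕ} (hn : n < N) (v : TreeVertex s) :
    inner ℂ (basisVec ((henselMap s)^[n] v))
      ((∑ n ∈ Finset.range N, diagOp (a n) * henselShift s ^ n) (basisVec v)) =
      a n (point ((henselMap s)^[n] v)) := by
  rw [sum_monomials_basisVec, inner_sum,
    Finset.sum_eq_single_of_mem n (Finset.mem_range.mpr hn)]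
  · rw [inner_smul_right, inner_self_eq_norm_sq_to_K, norm_basisVec]; simp
  · intro m _ hm
    rw [inner_smul_right, (orthonormal_basisVec s).2, mul_zero]
    intro h
    have := congrArg Sigma.fst h
    rw [henselMap_iterate_fst, henselMap_iterate_fst] at this
    omega

/-- An analytic polynomial never lowers the level. -/
theorem inner_sum_monomials_of_pos (a : ℕ → C(XV s, ℂ)) {N n : ℕ} (hn : 0 < n)
    (v : TreeVertex s) :
    inner ℂ (basisVec v) ((∑ n ∈ Finset.range N, diagOp (a n) * henselShift s ^ n)
      (basisVec ((henselMap s)^[n] v))) = 0 := by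
  rw [sum_monomials_basisVec, inner_sum]
  refine Finset.sum_eq_zero fun m _ => ?_
  rw [inner_smul_right, (orthonormal_basisVec s).2, mul_zero]
  intro h
  have := congrArg Sigma.fst h
  rw [henselMap_iterate_fst, henselMap_iterate_fst] at this
  omega

theorem inner_sum_monomials_of_zero (a : ℕ → C(XV s, ℂ)) (ha : a 0 = 0) (N n : ℕ)
    (v : TreeVertex s) :
    inner ℂ (basisVec v) ((∑ n ∈ Finset.range N, diagOp (a n) * henselShift s ^ n)
      (basisVec ((henselMap s)^[n] v))) = 0 := by
  rcases Nat.eq_zero_or_pos n with rfl | hn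
  · rw [sum_monomials_basisVec, inner_sum]
    refine Finset.sum_eq_zero fun m _ => ?_
    rcases Nat.eq_zero_or_pos m with rfl | hm
    · simp [ha]
    · rw [inner_smul_right, (orthonormal_basisVec s).2, mul_zero]
      intro h
      have := congrArg Sigma.fst h
      rw [henselMap_iterate_fst] at this
      simp at this
      omega
  · exact inner_sum_monomials_of_pos a hn v

/-- Entries that raise the level see only `a`, those that lower it see only `b`, and `b 0 = 0`
assigns the diagonal to `a`. Every entry is bounded by the operator norm. -/
theorem norm_coeff_le_of_decomposition {a b : ℕ → C(XV s, ℂ)} (hb : b 0 = 0) {N n : ℕ}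
    (hn : n < N) {T : TreeHilbert s →L[ℂ] TreeHilbert s}
    (hT : T = ∑ n ∈ Finset.range N, diagOp (a n) * henselShift s ^ n +
      star (∑ n ∈ Finset.range N, diagOp (b n) * henselShift s ^ n)) (v : TreeVertex s) :
    ‖a n (point ((henselMap s)^[n] v))‖ ≤ ‖T‖ ∧ ‖b n (point ((henselMap s)^[n] v))‖ ≤ ‖T‖ := by
  constructor
  · have h : inner ℂ (basisVec ((henselMap s)^[n] v)) (T (basisVec v)) =
        a n (point ((henselMap s)^[n] v)) := by
      rw [hT, _root_.add_apply, inner_add_right, inner_sum_monomials a hn,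
        ContinuousLinearMap.star_eq_adjoint, ContinuousLinearMap.adjoint_inner_right,
        ← inner_conj_symm, inner_sum_monomials_of_zero b hb, map_zero, add_zero]
    rw [← h]
    exact norm_inner_basisVec_le _ _ _
  · rcases Nat.eq_zero_or_pos n with rfl | h0
    · simp [hb]
    have h : inner ℂ (basisVec v) (T (basisVec ((henselMap s)^[n] v))) =
        starRingEnd ℂ (b n (point ((henselMap s)^[n] v))) := by
      rw [hT, _root_.add_apply, inner_add_right, inner_sum_monomials_of_pos a h0,
        ContinuousLinearMap.star_eq_adjoint, ContinuousLinearMap.adjoint_inner_right,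
        ← inner_conj_symm, inner_sum_monomials b hn, zero_add]
    rw [← Complex.norm_conj, ← h]
    exact norm_inner_basisVec_le _ _ _

/-! ### The isomorphism -/

/-- At vertex points `αⁿ(1)` is the indicator of the range of the `n`-th iterate of `henselMap`, so
`F Jⁿ` feels `F` only there. These are exactly the values that matrix entries can detect. -/
theorem norm_monomial_le {B : Type v} [CStarAlgebra B] (c : CovariantPair (alphaV s) B)
    {F : C(XV s, ℂ)} {n : ℕ} {C : ℝ} (h : ∀ v, ‖F (point ((henselMap s)^[n] v))‖ ≤ C) :
    ‖c.π F * c.J ^ n‖ ≤ C := by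
  have hC : 0 ≤ C := (norm_nonneg _).trans (h ⟨0, ⟨0, by simp⟩⟩)
  refine nonneg_le_nonneg_of_sq_le_sq hC ?_
  refine (CovariantPair.norm_monomial_sq F n).trans (norm_le_of_forall_point fun v => ?_)
  rw [ContinuousMap.mul_apply, ContinuousMap.mul_apply]
  by_cases hv : v ∈ Set.range (henselMap s)^[n]
  · obtain ⟨w, rfl⟩ := hv
    rw [alphaV_iterate_point, ContinuousMap.one_apply, mul_one, ContinuousMap.star_apply, norm_mul,
      norm_star]
    exact mul_self_le_mul_self (norm_nonneg _) (h w)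
  · rw [alphaV_iterate_point_of_notMem _ _ hv, mul_zero, zero_mul, norm_zero]
    exact mul_self_nonneg C

variable {φ : CrossedProduct (alphaV s) →⋆ₐ[ℂ] (TreeHilbert s →L[ℂ] TreeHilbert s)}

/-- Each of the `2(N + 1)` monomials of `x` has norm at most `‖φ x‖`; the constant is the number of
terms in the triangle inequality. -/
theorem norm_le_of_mem_degreeLE
    (hπ : ∀ F, φ ((CrossedProduct.univPair (alphaV s)).π F) = diagOp F)
    (hJ : φ (CrossedProduct.univPair (alphaV s)).J = henselShift s) (N : ℕ)
    (x : CrossedProduct (alphaV s)) (hx : x ∈ (CrossedProduct.univPair (alphaV s)).degreeLE N) :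
    ‖x‖ ≤ 2 * ((N : ℝ) + 1) * ‖φ x‖ := by
  obtain ⟨a, b, hb, h⟩ := CovariantPair.exists_coeffs hx
  have hT := congrArg φ h
  simp only [map_add, map_star, map_sum, map_mul, map_pow, hπ, hJ] at hT
  have key : ∀ d : ℕ → C(XV s, ℂ),
      (∀ n < N + 1, ∀ v, ‖d n (point ((henselMap s)^[n] v))‖ ≤ ‖φ x‖) →
      ‖∑ n ∈ Finset.range (N + 1), (CrossedProduct.univPair (alphaV s)).π (d n) *
        (CrossedProduct.univPair (alphaV s)).J ^ n‖ ≤ ((N : ℝ) + 1) * ‖φ x‖ := fun d hd => by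
    refine (norm_sum_le_of_le _ fun n hn =>
      norm_monomial_le _ (hd n (Finset.mem_range.mp hn))).trans ?_
    simp
  calc ‖x‖ ≤ ((N : ℝ) + 1) * ‖φ x‖ + ((N : ℝ) + 1) * ‖φ x‖ := by
        conv_lhs => rw [h]
        refine (norm_add_le _ _).trans (add_le_add ?_ ?_)
        · exact key a fun n hn v => (norm_coeff_le_of_decomposition hb hn hT v).1
        · rw [norm_star]
          exact key b fun n hn v => (norm_coeff_le_of_decomposition hb hn hT v).2
    _ = _ := by ring

theorem isometry_of_diagOp
    (hπ : ∀ F, φ ((CrossedProduct.univPair (alphaV s)).π F) = diagOp F)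
    (hJ : φ (CrossedProduct.univPair (alphaV s)).J = henselShift s) : Isometry φ := by
  have hcont : Continuous φ := AddMonoidHomClass.continuous_of_bound φ 1 fun x => by
    rw [one_mul]
    exact NonUnitalStarAlgHom.norm_apply_le φ x
  refine AddMonoidHomClass.isometry_of_norm φ fun x =>
    le_antisymm (NonUnitalStarAlgHom.norm_apply_le φ x) ?_
  -- Contractivity is automatic; the reverse inequality is a closed condition, so polynomials
  -- suffice.
  refine CrossedProduct.induction₁ (p := fun x => ‖x‖ ≤ ‖φ x‖)
    (isClosed_le continuous_norm hcont.norm) (fun x => ?_) x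
  rw [← CrossedProduct.univPair_eval]
  obtain ⟨N, hN⟩ := CovariantPair.exists_mem_degreeLE
    (c := CrossedProduct.univPair (alphaV s)) exists_alphaV_eq_corner x
  exact CovariantPair.norm_le_norm_map_of_linear_bound φ exists_alphaV_eq_corner
    (norm_le_of_mem_degreeLE hπ hJ) hN

/-! ### The range of the representation -/

/-- The function `(x, t) ↦ f x` on `X_V`. -/
def pullback (f : C(SAdicInt s, ℂ)) : C(XV s, ℂ) :=
  f.comp ⟨fun p => p.1.1, continuous_fst.comp continuous_subtype_val⟩

theorem diagOp_pullback (f : C(SAdicInt s, ℂ)) : diagOp (pullback f) = mulOp s f := by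
  ext ψ v
  rw [diagOp_apply, mulOp_apply, ← point_fst]
  rfl

variable (s) in
theorem henselShift_mem : henselShift s ∈ HenselAlgebra s :=
  StarSubalgebra.le_topologicalClosure _ (StarAlgebra.subset_adjoin _ _ (Or.inl rfl))

theorem mulOp_mem (f : C(SAdicInt s, ℂ)) : mulOp s f ∈ HenselAlgebra s :=
  StarSubalgebra.le_topologicalClosure _ (StarAlgebra.subset_adjoin _ _ (Or.inr ⟨f, rfl⟩))

theorem diagOp_alphaV_mem {F : C(XV s, ℂ)} (hF : diagOp F ∈ HenselAlgebra s) :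
    diagOp (alphaV s F) ∈ HenselAlgebra s := by
  rw [diagOp_alphaV]
  exact mul_mem (mul_mem (henselShift_mem s) hF) (star_mem (henselShift_mem s))

/-- These operators are the range projections of the powers `Vⁿ`. They supply the functions that
tell apart the points over `0`, which the `M_f` cannot do. -/
theorem diagOp_alphaV_iterate_one_mem (n : ℕ) :
    diagOp ((alphaV s)^[n] 1) ∈ HenselAlgebra s := by
  induction n with
  | zero =>
    have h : diagOp (1 : C(XV s, ℂ)) = 1 := map_one (diagRep s)
    rw [Function.iterate_zero_apply, h]
    exact one_mem _
  | succ n ih => rw [Function.iterate_succ_apply']; exact diagOp_alphaV_mem ih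

theorem alphaV_iterate_one_spike_of_lt {n m : ℕ} (h : m < n) :
    (alphaV s)^[n] 1 (spike s m) = 0 := by
  induction n generalizing m with
  | zero => omega
  | succ n ih =>
    rw [Function.iterate_succ_apply']
    cases m with
    | zero => exact alphaV_spike_zero _
    | succ m => rw [alphaV_spike_succ]; exact ih (by omega)

theorem alphaV_iterate_one_spike_of_le {n m : ℕ} (h : n ≤ m) :
    (alphaV s)^[n] 1 (spike s m) = 1 := by
  induction n generalizing m with
  | zero => rfl
  | succ n ih =>
    rw [Function.iterate_succ_apply']
    cases m with
    | zero => omega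
    | succ m => rw [alphaV_spike_succ]; exact ih (by omega)

/-- By continuity: `αⁿ(1)` equals `1` at all spike points from index `n` on, and these tend to `(0,
0)`. -/
theorem alphaV_iterate_one_base_zero (n : ℕ) :
    (alphaV s)^[n] 1 (base (0 : SAdicInt s)) = 1 := by
  refine tendsto_nhds_unique ((((alphaV s)^[n] 1).continuous.tendsto _).comp tendsto_spike)
    (tendsto_const_nhds.congr' ?_)
  filter_upwards [eventually_ge_atTop n] with m hm
  exact (alphaV_iterate_one_spike_of_le hm).symm

/-- Distinct points with the same `s`-adic coordinate lie over `0`. There `αⁿ⁺¹(1)` vanishes at the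
spike point `n` and equals `1` at all later ones and at `(0, 0)`. -/
theorem exists_alphaV_iterate_one_ne {p q : XV s} (hpq : p ≠ q) (h1 : p.1.1 = q.1.1) :
    ∃ n, (alphaV s)^[n] 1 p ≠ (alphaV s)^[n] 1 q := by
  have key : ∀ n, ∃ k, (alphaV s)^[k] 1 (base (0 : SAdicInt s)) ≠ (alphaV s)^[k] 1 (spike s n) :=
    fun n => ⟨n + 1, by
      rw [alphaV_iterate_one_base_zero, alphaV_iterate_one_spike_of_lt n.lt_succ_self]
      exact one_ne_zero⟩
  have key2 : ∀ n m, n < m →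
      ∃ k, (alphaV s)^[k] 1 (spike s m) ≠ (alphaV s)^[k] 1 (spike s n) :=
    fun n m h => ⟨n + 1, by
      rw [alphaV_iterate_one_spike_of_le h, alphaV_iterate_one_spike_of_lt n.lt_succ_self]
      exact one_ne_zero⟩
  obtain ⟨x, rfl⟩ | ⟨n, rfl⟩ := eq_base_or_spike p <;>
    obtain ⟨y, rfl⟩ | ⟨m, rfl⟩ := eq_base_or_spike q
  · exact absurd (congrArg base h1) hpq
  · obtain rfl : x = 0 := h1
    exact key m
  · obtain rfl : 0 = y := h1
    exact (key n).imp fun _ h => h.symm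
  · rcases lt_trichotomy n m with h | rfl | h
    · exact (key2 n m h).imp fun _ h => h.symm
    · exact absurd rfl hpq
    · exact key2 m n h

theorem exists_continuousMap_ne {x y : SAdicInt s} (h : x ≠ y) :
    ∃ f : C(SAdicInt s, ℂ), f x ≠ f y := by
  obtain ⟨n, hn⟩ : ∃ n, x.1 n ≠ y.1 n := by
    by_contra! h'
    exact h (ext' h')
  refine ⟨⟨fun z => (((z.1 n).val : ℕ) : ℂ), ?_⟩, fun he => hn ?_⟩
  · exact (continuous_of_discreteTopology (f := fun a : ZMod (s ^ n) => ((a.val : ℕ) : ℂ))).comp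
      ((continuous_apply n).comp continuous_subtype_val)
  · exact ZMod.val_injective _ (Nat.cast_injective (R := ℂ) he)

/-- Stone–Weierstrass for the closed `*`-subalgebra of admissible `F`: pullbacks separate points
with different `s`-adic coordinates, the functions `αⁿ(1)` the remaining pairs. -/
theorem diagOp_mem (F : C(XV s, ℂ)) : diagOp F ∈ HenselAlgebra s := by
  have hcont : Continuous (diagRep s) := AddMonoidHomClass.continuous_of_bound (diagRep s) 1
    fun x => by
      rw [one_mul]
      exact NonUnitalStarAlgHom.norm_apply_le (diagRep s) x
  let S : StarSubalgebra ℂ C(XV s, ℂ) := (HenselAlgebra s).comap (diagRep s)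
  have hclosed : IsClosed (S : Set C(XV s, ℂ)) :=
    (StarSubalgebra.isClosed_topologicalClosure _).preimage hcont
  have hsep : S.SeparatesPoints := by
    intro p q hpq
    by_cases h1 : p.1.1 = q.1.1
    · obtain ⟨n, hn⟩ := exists_alphaV_iterate_one_ne hpq h1
      exact ⟨_, ⟨_, diagOp_alphaV_iterate_one_mem n, rfl⟩, hn⟩
    · obtain ⟨f, hf⟩ := exists_continuousMap_ne h1
      refine ⟨_, ⟨pullback f, ?_, rfl⟩, hf⟩
      change diagOp (pullback f) ∈ HenselAlgebra s
      rw [diagOp_pullback]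
      exact mulOp_mem f
  have htop := ContinuousMap.starSubalgebra_topologicalClosure_eq_top_of_separatesPoints S hsep
  have hle : S.topologicalClosure ≤ S := StarSubalgebra.topologicalClosure_minimal le_rfl hclosed
  rw [htop] at hle
  exact hle trivial

theorem range_eq_henselAlgebra
    (hπ : ∀ F, φ ((CrossedProduct.univPair (alphaV s)).π F) = diagOp F)
    (hJ : φ (CrossedProduct.univPair (alphaV s)).J = henselShift s) :
    φ.range = HenselAlgebra s := by
  have hiso := isometry_of_diagOp hπ hJ
  refine le_antisymm ?_ ?_
  · rintro _ ⟨x, rfl⟩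
    refine CrossedProduct.induction₁ (p := fun x => φ x ∈ HenselAlgebra s)
      ((StarSubalgebra.isClosed_topologicalClosure _).preimage hiso.continuous) (fun x => ?_) x
    rw [← CrossedProduct.univPair_eval]
    induction x using CrossedPoly.induction with
    | scalar r =>
      rw [AlgHom.commutes, AlgHomClass.commutes]
      exact (HenselAlgebra s).algebraMap_mem r
    | gen g =>
      cases g with
      | coeff F => rw [CovariantPair.eval_coeff, hπ]; exact diagOp_mem F
      | iso => rw [CovariantPair.eval_iso, hJ]; exact henselShift_mem s
      | isoStar =>
        rw [CovariantPair.eval_isoStar, map_star, hJ]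
        exact star_mem (henselShift_mem s)
    | mul x y hx hy => rw [map_mul, map_mul]; exact mul_mem hx hy
    | add x y hx hy => rw [map_add, map_add]; exact add_mem hx hy
  · refine StarSubalgebra.topologicalClosure_minimal ?_ ?_
    · rw [StarAlgebra.adjoin_le_iff]
      rintro _ (rfl | ⟨f, rfl⟩)
      · exact ⟨_, hJ⟩
      · exact ⟨_, (hπ (pullback f)).trans (diagOp_pullback f)⟩
    -- The range is closed because `φ` is isometric on a complete space, so it contains the closure
    -- of the algebra generated by `V` and the `M_f`.
    · exact hiso.isClosedEmbedding.isClosed_range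

end XV

end HenselRepresentation

/-- The Hensel shift algebra is the crossed product of `C(X_V)` by the endomorphism `α̃_V`. -/
theorem mainTheorem3 (s : ℕ) [s.AtLeastTwo] :
    Nonempty (HenselAlgebra s ≃⋆ₐ[ℂ] CrossedProduct (XV.alphaV s)) := by
  obtain ⟨φ, hπ, hJ⟩ := CrossedProduct.exists_lift (XV.henselPair s)
  rw [← XV.range_eq_henselAlgebra hπ hJ]
  exact ⟨(StarAlgEquiv.ofInjective φ (XV.isometry_of_diagOp hπ hJ).injective).symm⟩
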